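/- Let $0<\alpha<1$ and let $p_\alpha(t,x)$, $t,x>0$, be the positive $\alpha$-stable kernel: for every $t>0$, $p_\alpha(t,\cdot)$ is the (unique, existing) continuous nonnegative function on $(0,\infty)$ with Laplace transform $$\int_0^\infty p_\alpha(t,x)\,e^{-\lambda x}\,dx = e^{-t\lambda^\alpha},\qquad \lambda>0.$$ A kernel $K:(0,\infty)\times(0,\infty)\to\mathbb{R}$ is called totally positive of order $n$ ($\mathrm{TP}_n$) if $\det[K(x_i,y_j)]_{1\le i,j\le m}\ge 0$ for every $m\in\{1,\dots,n\}$, all $0<x_1<\dots<x_m$ and all $0<y_1<\dots<y_m$. Then, for every $n\ge 2$, the kernel $(t,x)\mapsto p_\alpha(t,x)$ is $\mathrm{TP}_n$ if and only if $\alpha\in\{1/2,1/3,\dots,1/n\}$ or $\alpha<1/n$. -/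

import Mathlib

open MeasureTheory Set

/-- The kernel `K` is totally positive of order `n` on `I × I`: all minors of size `m ∈ {1, …, n}`
taken at increasing points of `I` are nonnegative. -/
def IsTotallyPositive (n : ℕ) (I : Set ℝ) (K : ℝ → ℝ → ℝ) : Prop :=
  ∀ m : ℕ, 1 ≤ m → m ≤ n → ∀ x y : Fin m → ℝ,
    StrictMono x → StrictMono y → (∀ i, x i ∈ I) → (∀ j, y j ∈ I) →
      0 ≤ (Matrix.of fun i j => K (x i) (y j)).det

/-- `p` is the positive `α`-stable kernel `(t, x) ↦ p t x`, `t, x > 0`: for every time `t > 0`,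
`p t` is the continuous (nonnegative) density on `(0, ∞)` whose Laplace transform is
`l ↦ exp (-t l ^ α)`. Total mass one follows on letting `l → 0`, and the values `p t x` for
`t, x > 0` are determined by these conditions. -/
structure IsPositiveStableKernel (α : ℝ) (p : ℝ → ℝ → ℝ) : Prop where
  continuousOn : ∀ t, 0 < t → ContinuousOn (p t) (Ioi 0)
  nonneg : ∀ t, 0 < t → ∀ x, 0 < x → 0 ≤ p t x
  integrableOn : ∀ t, 0 < t → ∀ l : ℝ, 0 < l →
    IntegrableOn (fun x => p t x * Real.exp (-(l * x))) (Ioi 0)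
  laplace : ∀ t, 0 < t → ∀ l : ℝ, 0 < l →
    ∫ x in Ioi (0 : ℝ), p t x * Real.exp (-(l * x)) = Real.exp (-(t * l ^ α))

/-!
Write `w = t l ^ α`. By the Post–Widder formula `p t x` is the limit of the suitably scaled moments
`∫ x ^ k exp (-l x) p t x dx = (-d/dl) ^ k exp (-w)` at `l = (k + 1) / x`, so the sign of the minors
of `p` can be read off from these moments.

*Sufficiency.* For `k = 0` the moment is the exponential kernel in `t` and `-l ^ α`. Each further
moment is, up to a factor depending only on `t`, the fractional integral of order `1 / α - 1` in `t`
of the preceding one. By Andréief's identity total positivity of order `n` propagates as soon as the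
truncated power `z₊ ^ (1 / α - 2)` has it as a convolution kernel, which is the case when the
exponent is a natural number or at least `n - 2`.

*Necessity.* The kernel of second moments is, up to factors depending on `t` or `l` alone,
`exp (-w) (1 - α + α w)`. Its minors of size `k + 1` at small times are asymptotically a positive
multiple of the product of its Taylor coefficients, hence `∏ l ≤ k, (1 - (l + 1) α) ≥ 0`; when
`k α < 1 < (k + 1) α` exactly the last factor is negative.

*Existence.* The Bromwich integral of `exp (-t z ^ α)` converges absolutely and has the right
Laplace transform. It is nonnegative by Post–Widder, since the moments are.
-/

open Filter
open scoped Topology FourierTransform Nat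

/-! ### Determinants of integrals -/

section Determinants

variable {ι E : Type*} [Fintype ι] [DecidableEq ι] [MeasurableSpace E]

theorem integrable_det {μ : ι → Measure E} [∀ j, SigmaFinite (μ j)] {q : ι → ι → E → ℝ}
    (hq : ∀ i j, Integrable (q i j) (μ j)) :
    Integrable (fun s : ι → E => (Matrix.of fun i j => q i j (s j)).det) (Measure.pi μ) := by
  simp only [Matrix.det_apply', Matrix.of_apply]
  exact integrable_finsetSum _ fun σ _ =>
    (Integrable.fintype_prod (f := fun j => q (σ j) j) fun j => hq _ _).const_mul _

theorem integral_det {μ : ι → Measure E} [∀ j, SigmaFinite (μ j)] {q : ι → ι → E → ℝ}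
    (hq : ∀ i j, Integrable (q i j) (μ j)) :
    ∫ s : ι → E, (Matrix.of fun i j => q i j (s j)).det ∂Measure.pi μ =
      (Matrix.of fun i j => ∫ s, q i j s ∂μ j).det := by
  simp only [Matrix.det_apply', Matrix.of_apply]
  rw [integral_finsetSum _ fun σ _ =>
    (Integrable.fintype_prod (f := fun j => q (σ j) j) fun j => hq _ _).const_mul _]
  refine Finset.sum_congr rfl fun σ _ => ?_
  rw [integral_const_mul, integral_fintype_prod_eq_prod (fun j => q (σ j) j)]

/-- Andréief's identity, the continuous Cauchy–Binet formula. -/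
theorem integral_det_mul_det {μ : Measure E} [SigmaFinite μ] {K L : ι → E → ℝ}
    (hKL : ∀ i j, Integrable (fun s => K i s * L j s) μ) :
    ∫ s : ι → E, (Matrix.of fun i j => K i (s j)).det * (Matrix.of fun i j => L j (s i)).det
        ∂Measure.pi (fun _ => μ) =
      (Fintype.card ι)! * (Matrix.of fun i j => ∫ s, K i s * L j s ∂μ).det := by
  set A : Matrix ι ι ℝ := Matrix.of fun i j => ∫ s, K i s * L j s ∂μ
  have expand (s : ι → E) :
      (Matrix.of fun i j => K i (s j)).det * (Matrix.of fun i j => L j (s i)).det =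
        ∑ σ : Equiv.Perm ι,
          (σ.sign : ℝ) * (Matrix.of fun i j => K i (s j) * L (σ j) (s j)).det := by
    rw [← Matrix.det_transpose (Matrix.of fun i j => L j (s i)),
      Matrix.det_apply' (Matrix.of fun i j => L j (s i)).transpose, Finset.mul_sum]
    refine Finset.sum_congr rfl fun σ _ => ?_
    have scale := Matrix.det_mul_row (fun j => L (σ j) (s j)) (Matrix.of fun i j => K i (s j))
    simp only [Matrix.of_apply, mul_comm (L _ _)] at scale
    simp only [scale, Matrix.transpose_apply, Matrix.of_apply]
    ring
  have integral_term (σ : Equiv.Perm ι) :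
      ∫ s : ι → E, (σ.sign : ℝ) * (Matrix.of fun i j => K i (s j) * L (σ j) (s j)).det
        ∂Measure.pi (fun _ => μ) = A.det := by
    have permuted : (Matrix.of fun i j => ∫ s, K i s * L (σ j) s ∂μ) = A.submatrix id σ := rfl
    rw [integral_const_mul, integral_det (q := fun i j s => K i s * L (σ j) s)
      fun i j => hKL i (σ j), permuted, Matrix.det_permute', ← mul_assoc, ← Int.cast_mul,
      ← Units.val_mul, Int.units_mul_self, Units.val_one, Int.cast_one, one_mul]
  simp only [expand]
  rw [integral_finsetSum _ fun σ _ => (integrable_det (q := fun i j s => K i s * L (σ j) s)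
    fun i j => hKL i (σ j)).const_mul _]
  simp only [integral_term, Finset.sum_const, Finset.card_univ, Fintype.card_perm, nsmul_eq_mul]

end Determinants

section Composition

variable {m : ℕ} {E : Type*} [LinearOrder E] {I : Set E} {K L : Fin m → E → ℝ}

theorem det_mul_det_nonneg_of_strictMono
    (hK : ∀ s, StrictMono s → (∀ i, s i ∈ I) → 0 ≤ (Matrix.of fun i j => K i (s j)).det)
    (hL : ∀ s, StrictMono s → (∀ i, s i ∈ I) → 0 ≤ (Matrix.of fun i j => L j (s i)).det)
    {s : Fin m → E} (hs : ∀ i, s i ∈ I) :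
    0 ≤ (Matrix.of fun i j => K i (s j)).det * (Matrix.of fun i j => L j (s i)).det := by
  by_cases hinj : Function.Injective s
  · set σ := Tuple.sort s
    have hmono : StrictMono (s ∘ σ) :=
      (Tuple.monotone_sort s).strictMono_of_injective (hinj.comp σ.injective)
    have sorted := mul_nonneg (hK _ hmono fun i => hs _) (hL _ hmono fun i => hs _)
    have permute (A B : Matrix (Fin m) (Fin m) ℝ) :
        (A.submatrix id σ).det * (B.submatrix σ id).det = A.det * B.det := by
      rw [← Matrix.det_mul, Matrix.submatrix_mul_equiv, Matrix.submatrix_id_id, Matrix.det_mul]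
    exact sorted.trans_eq
      (permute (Matrix.of fun i j => K i (s j)) (Matrix.of fun i j => L j (s i)))
  · obtain ⟨a, b, hab, hne⟩ := Function.not_injective_iff.1 hinj
    rw [Matrix.det_zero_of_column_eq (M := Matrix.of fun i j => K i (s j)) hne
      (fun i => by simp only [Matrix.of_apply, hab]), zero_mul]

theorem det_integral_mul_nonneg [MeasurableSpace E] {μ : Measure E} [SigmaFinite μ]
    (hI : ∀ᵐ s ∂μ, s ∈ I) (hKL : ∀ i j, Integrable (fun s => K i s * L j s) μ)
    (hK : ∀ s, StrictMono s → (∀ i, s i ∈ I) → 0 ≤ (Matrix.of fun i j => K i (s j)).det)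
    (hL : ∀ s, StrictMono s → (∀ i, s i ∈ I) → 0 ≤ (Matrix.of fun i j => L j (s i)).det) :
    0 ≤ (Matrix.of fun i j => ∫ s, K i s * L j s ∂μ).det := by
  have hall : ∀ᵐ s ∂Measure.pi fun _ : Fin m => μ, ∀ i, s i ∈ I :=
    ae_all_iff.2 fun i => (Measure.quasiMeasurePreserving_eval (fun _ => μ) i).ae hI
  have andreief := integral_det_mul_det hKL
  refine nonneg_of_mul_nonneg_right (andreief ▸ integral_nonneg_of_ae ?_)
    (Nat.cast_pos.2 (Nat.factorial_pos _))
  filter_upwards [hall] with s hs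
  exact det_mul_det_nonneg_of_strictMono hK hL hs

end Composition

theorem det_intervalIntegral_nonneg {m : ℕ} {q : Fin m → ℝ → ℝ} {v : Fin (m + 1) → ℝ}
    (hq : ∀ i a b, IntervalIntegrable (q i) volume a b)
    (hdet : ∀ s, StrictMono s → 0 ≤ (Matrix.of fun i j => q i (s j)).det) (hv : StrictMono v) :
    0 ≤ (Matrix.of fun i (j : Fin m) => ∫ s in v j.castSucc..v j.succ, q i s).det := by
  have hle (j : Fin m) : v j.castSucc ≤ v j.succ := (hv j.castSucc_lt_succ).le
  simp only [intervalIntegral.integral_of_le (hle _)]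
  rw [← integral_det (q := fun i _ => q i) fun i j => (hq i _ _).1, ← Measure.restrict_pi_pi]
  refine setIntegral_nonneg (MeasurableSet.univ_pi fun _ => measurableSet_Ioc) fun s hs => ?_
  refine hdet s fun i j hij => ?_
  calc s i ≤ v i.succ := (hs i (mem_univ i)).2
    _ ≤ v j.castSucc := hv.monotone (Fin.succ_le_castSucc_iff.2 hij)
    _ < s j := (hs j (mem_univ j)).1

/-! ### Truncated powers -/

/-- The truncated power `z₊ ^ a`, the kernel of fractional integration. Its value is `0` for `z ≤ 0`
also when `a ≤ 0`. -/
noncomputable def truncPow (a : ℝ) : ℝ → ℝ := (Ioi 0).indicator fun z => z ^ a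

theorem truncPow_of_pos {a z : ℝ} (hz : 0 < z) : truncPow a z = z ^ a := indicator_of_mem hz _

theorem truncPow_of_nonpos {a z : ℝ} (hz : z ≤ 0) : truncPow a z = 0 :=
  indicator_of_notMem (notMem_Ioi.2 hz) _

theorem truncPow_nonneg (a z : ℝ) : 0 ≤ truncPow a z :=
  indicator_nonneg (fun _ hz => Real.rpow_nonneg (mem_Ioi.1 hz).le a) z

theorem truncPow_mul {a c : ℝ} (hc : 0 < c) (z : ℝ) :
    truncPow a (c * z) = c ^ a * truncPow a z := by
  rcases lt_or_ge 0 z with hz | hz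
  · rw [truncPow_of_pos hz, truncPow_of_pos (mul_pos hc hz), Real.mul_rpow hc.le hz.le]
  · rw [truncPow_of_nonpos hz, truncPow_of_nonpos (mul_nonpos_of_nonneg_of_nonpos hc.le hz),
      mul_zero]

@[fun_prop]
theorem measurable_truncPow (a : ℝ) : Measurable (truncPow a) :=
  Measurable.indicator (by fun_prop) measurableSet_Ioi

theorem intervalIntegrable_truncPow {a : ℝ} (ha : -1 < a) (u v : ℝ) :
    IntervalIntegrable (truncPow a) volume u v := by
  have h := intervalIntegral.intervalIntegrable_rpow' (a := u) (b := v) ha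
  exact ⟨h.1.indicator measurableSet_Ioi, h.2.indicator measurableSet_Ioi⟩

theorem integral_zero_truncPow {a : ℝ} (ha : -1 < a) (v : ℝ) :
    ∫ s in (0 : ℝ)..v, truncPow a s = truncPow (a + 1) v / (a + 1) := by
  rcases le_or_gt v 0 with hv | hv
  · rw [truncPow_of_nonpos hv, zero_div,
      intervalIntegral.integral_congr (g := fun _ => 0) fun s hs =>
        truncPow_of_nonpos (uIcc_of_ge hv ▸ hs).2, intervalIntegral.integral_zero]
  · rw [truncPow_of_pos hv, intervalIntegral.integral_of_le hv.le,
      setIntegral_congr_fun measurableSet_Ioc fun s hs => truncPow_of_pos hs.1,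
      ← intervalIntegral.integral_of_le hv.le, integral_rpow (Or.inl ha),
      Real.zero_rpow (by linarith), sub_zero]

theorem integral_truncPow {a : ℝ} (ha : -1 < a) (u v : ℝ) :
    ∫ s in u..v, truncPow a s = (truncPow (a + 1) v - truncPow (a + 1) u) / (a + 1) := by
  rw [sub_div, ← integral_zero_truncPow ha, ← integral_zero_truncPow ha,
    intervalIntegral.integral_interval_sub_left (intervalIntegrable_truncPow ha _ _)
      (intervalIntegrable_truncPow ha _ _)]

theorem det_truncPow_eq_zero {m : ℕ} {x y : Fin (m + 1) → ℝ} (a : ℝ) (hx : Monotone x)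
    (h : y 0 ≤ x 0) : (Matrix.of fun i j => truncPow a (y j - x i)).det = 0 :=
  Matrix.det_eq_zero_of_column_eq_zero 0 fun i =>
    truncPow_of_nonpos (sub_nonpos.2 (h.trans (hx (Fin.zero_le i))))

theorem det_truncPow_zero_nonneg {m : ℕ} {x y : Fin m → ℝ} (hx : StrictMono x)
    (hy : StrictMono y) : 0 ≤ (Matrix.of fun i j => truncPow 0 (y j - x i)).det := by
  induction m with
  | zero => rw [Matrix.det_fin_zero]; exact zero_le_one
  | succ m ih =>
    rcases le_or_gt (y 0) (x 0) with h0 | h0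
    · exact (det_truncPow_eq_zero 0 hx.monotone h0).ge
    have row_one {i : Fin (m + 1)} (hi : x i < y 0) (j : Fin (m + 1)) :
        truncPow 0 (y j - x i) = 1 := by
      rw [truncPow_of_pos (sub_pos.2 (hi.trans_le (hy.monotone (Fin.zero_le j)))), Real.rpow_zero]
    by_cases h1 : ∃ i, i ≠ 0 ∧ x i < y 0
    · obtain ⟨i, hi, hlt⟩ := h1
      refine (Matrix.det_zero_of_row_eq hi (funext fun j => ?_)).ge
      simp only [Matrix.of_apply, row_one hlt, row_one h0]
    · push Not at h1
      have column_zero (i : Fin m) : truncPow 0 (y 0 - x i.succ) = 0 :=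
        truncPow_of_nonpos (sub_nonpos.2 (h1 i.succ (Fin.succ_ne_zero i)))
      rw [Matrix.det_succ_column_zero, Fin.sum_univ_succ]
      simpa [column_zero, row_one h0, Matrix.submatrix, Function.comp_def] using
        ih (hx.comp Fin.strictMono_succ) (hy.comp Fin.strictMono_succ)

theorem det_eq_det_sub_of_row_zero_eq_one {R : Type*} [CommRing R] {m : ℕ}
    {A : Matrix (Fin (m + 1)) (Fin (m + 1)) R} (hA : ∀ j, A 0 j = 1) :
    A.det = (Matrix.of fun i j : Fin m => A i.succ j.succ - A i.succ j.castSucc).det := by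
  rw [Matrix.det_eq_of_forall_col_eq_smul_add_pred (A := A)
    (B := Matrix.of fun i => Fin.cases (A i 0) fun j => A i j.succ - A i j.castSucc)
    (fun _ => 1) (fun i => rfl) (fun i j => by simp), Matrix.det_succ_row_zero,
    Fin.sum_univ_succ]
  simp only [Matrix.of_apply, hA, sub_self, Fin.cases_zero, Fin.cases_succ, mul_zero, zero_mul,
    Finset.sum_const_zero, add_zero, Fin.val_zero, pow_zero, one_mul, Fin.succAbove_zero]
  rfl

/-- The substitution `z ↦ -(z - x 0)⁻¹` is increasing to the right of `x 0`, and it turns the first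
row into ones once powers of `y j - x 0` and `x i - x 0` are pulled out. -/
theorem det_truncPow_succ {m : ℕ} {a : ℝ} (ha : -1 < a) {x y : Fin (m + 1) → ℝ}
    (hx : StrictMono x) (hxy : ∀ j, x 0 < y j) :
    (Matrix.of fun i j => truncPow (a + 1) (y j - x i)).det =
      (∏ j, (y j - x 0) ^ (a + 1)) * ((∏ i : Fin m, (x i.succ - x 0) ^ (a + 1) * (a + 1)) *
        (Matrix.of fun i j : Fin m => ∫ s in -(y j.castSucc - x 0)⁻¹..-(y j.succ - x 0)⁻¹,
          truncPow a (s - -(x i.succ - x 0)⁻¹)).det) := by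
  have hr (j) : 0 < y j - x 0 := sub_pos.2 (hxy j)
  have hd (i : Fin m) : 0 < x i.succ - x 0 := sub_pos.2 (hx (Fin.succ_pos i))
  have pull_columns (i j) : truncPow (a + 1) (y j - x i) =
      (y j - x 0) ^ (a + 1) * truncPow (a + 1) (1 + (x i - x 0) * -(y j - x 0)⁻¹) := by
    rw [← truncPow_mul (hr j)]
    congr 1
    have := (hr j).ne'
    field_simp
    ring
  have pull_rows (i : Fin m) (z) : truncPow (a + 1) (1 + (x i.succ - x 0) * z) =
      (x i.succ - x 0) ^ (a + 1) * truncPow (a + 1) (z - -(x i.succ - x 0)⁻¹) := by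
    rw [← truncPow_mul (hd i)]
    congr 1
    have := (hd i).ne'
    field_simp
    ring
  set B : Matrix (Fin (m + 1)) (Fin (m + 1)) ℝ :=
    Matrix.of fun i j => truncPow (a + 1) (1 + (x i - x 0) * -(y j - x 0)⁻¹)
  have row_one (j) : B 0 j = 1 := by
    simp only [B, Matrix.of_apply, sub_self, zero_mul, add_zero, truncPow_of_pos one_pos,
      Real.one_rpow]
  have entry (i j : Fin m) : B i.succ j.succ - B i.succ j.castSucc =
      (x i.succ - x 0) ^ (a + 1) * (a + 1) *
        ∫ s in -(y j.castSucc - x 0)⁻¹..-(y j.succ - x 0)⁻¹,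
          truncPow a (s - -(x i.succ - x 0)⁻¹) := by
    rw [intervalIntegral.integral_comp_sub_right (truncPow a), integral_truncPow ha]
    simp only [B, Matrix.of_apply, pull_rows]
    have : a + 1 ≠ 0 := by linarith
    field_simp
  calc (Matrix.of fun i j => truncPow (a + 1) (y j - x i)).det
      = (Matrix.of fun i j => (y j - x 0) ^ (a + 1) * B i j).det := by
        simp only [pull_columns, B, Matrix.of_apply]
    _ = (∏ j, (y j - x 0) ^ (a + 1)) * B.det := Matrix.det_mul_row _ _
    _ = _ := by
        rw [det_eq_det_sub_of_row_zero_eq_one row_one, ← Matrix.det_mul_column]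
        simp only [entry, Matrix.of_apply]

theorem det_truncPow_nonneg {m : ℕ} {a : ℝ} (ha : (∃ k : ℕ, k = a) ∨ (m : ℝ) - 2 ≤ a)
    {x y : Fin m → ℝ} (hx : StrictMono x) (hy : StrictMono y) :
    0 ≤ (Matrix.of fun i j => truncPow a (y j - x i)).det := by
  induction m generalizing a with
  | zero => rw [Matrix.det_fin_zero]; exact zero_le_one
  | succ m ih =>
    rcases Nat.eq_zero_or_pos m with rfl | hm
    · rw [Matrix.det_fin_one]
      exact truncPow_nonneg _ _
    rcases eq_or_ne a 0 with rfl | ha0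
    · exact det_truncPow_zero_nonneg hx hy
    rcases le_or_gt (y 0) (x 0) with hxy | hxy
    · exact (det_truncPow_eq_zero a hx.monotone hxy).ge
    have hxy (j) : x 0 < y j := hxy.trans_le (hy.monotone (Fin.zero_le j))
    have hpred : (∃ k : ℕ, k = a - 1) ∨ (m : ℝ) - 2 ≤ a - 1 := by
      refine ha.imp ?_ fun h => by push_cast at h; linarith
      rintro ⟨k, rfl⟩
      obtain ⟨k, rfl⟩ := Nat.exists_eq_succ_of_ne_zero (Nat.cast_ne_zero.1 ha0)
      exact ⟨k, by push_cast; ring⟩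
    have ha1 : -1 < a - 1 := by
      rcases hpred with ⟨k, hk⟩ | h
      · exact hk ▸ neg_one_lt_zero.trans_le k.cast_nonneg
      · have : (1 : ℝ) ≤ m := by exact_mod_cast hm
        exact lt_of_le_of_ne (by linarith) fun h => ha0 (by linarith)
    have hd {z w} (hz : x 0 < z) (hzw : z < w) : -(z - x 0)⁻¹ < -(w - x 0)⁻¹ :=
      neg_lt_neg (inv_strictAnti₀ (sub_pos.2 hz) (sub_lt_sub_right hzw _))
    rw [← sub_add_cancel a 1, det_truncPow_succ ha1 hx hxy]
    refine mul_nonneg (Finset.prod_nonneg fun j _ => Real.rpow_nonneg (sub_pos.2 (hxy j)).le _)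
      (mul_nonneg (Finset.prod_nonneg fun i _ => mul_nonneg (Real.rpow_nonneg
        (sub_pos.2 (hx (Fin.succ_pos i))).le _) (by linarith)) ?_)
    refine det_intervalIntegral_nonneg (q := fun i s => truncPow (a - 1) (s - -(x i.succ - x 0)⁻¹))
      (v := fun j => -(y j - x 0)⁻¹) (fun i u v => ?_) (fun s hs => ?_) fun i j hij =>
        hd (hxy i) (hy hij)
    · have shift := (intervalIntegrable_truncPow ha1 (u - -(x i.succ - x 0)⁻¹)
        (v - -(x i.succ - x 0)⁻¹)).comp_sub_right (-(x i.succ - x 0)⁻¹)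
      simpa only [sub_add_cancel] using shift
    · exact ih hpred (fun i j hij => hd (hx (Fin.succ_pos i)) (hx (Fin.succ_lt_succ_iff.2 hij))) hs

theorem tendsto_truncPow_one_add_div (z : ℝ) :
    Tendsto (fun N : ℕ => truncPow N (1 + z / N)) atTop (𝓝 (Real.exp z)) := by
  have hlim : Tendsto (fun N : ℕ => 1 + z / N) atTop (𝓝 (1 + 0)) :=
    (tendsto_const_div_atTop_nhds_zero_nat z).const_add 1
  rw [add_zero] at hlim
  refine (Real.tendsto_one_add_div_pow_exp z).congr' ?_
  filter_upwards [hlim.eventually (lt_mem_nhds one_pos)] with N hN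
  rw [truncPow_of_pos hN, Real.rpow_natCast]

theorem det_exp_mul_nonneg_of_pos {m : ℕ} {x y : Fin m → ℝ} (hx : StrictMono x)
    (hy : StrictMono y) (hpos : ∀ i, 0 < x i) :
    0 ≤ (Matrix.of fun i j => Real.exp (x i * y j)).det := by
  have hlim : Tendsto (fun N : ℕ => (Matrix.of fun i j => truncPow N (1 + x i * y j / N)).det)
      atTop (𝓝 (Matrix.of fun i j => Real.exp (x i * y j)).det) :=
    (continuous_id.matrix_det.tendsto _).comp <| tendsto_pi_nhds.2 fun i =>
      tendsto_pi_nhds.2 fun j => tendsto_truncPow_one_add_div (x i * y j)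
  refine ge_of_tendsto hlim ?_
  filter_upwards [eventually_gt_atTop 0] with N hN
  have hN : (0 : ℝ) < N := Nat.cast_pos.2 hN
  have factor (i j) : truncPow N (1 + x i * y j / N) =
      (x i / N) ^ (N : ℝ) * truncPow N (y j - -(N / x i)) := by
    rw [← truncPow_mul (div_pos (hpos i) hN)]
    congr 1
    have := (hpos i).ne'
    field_simp
    ring
  have scale := Matrix.det_mul_column (fun i => (x i / N) ^ (N : ℝ))
    (Matrix.of fun i j => truncPow N (y j - -(N / x i)))
  simp only [factor]
  refine (mul_nonneg (Finset.prod_nonneg fun i _ =>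
    Real.rpow_nonneg (div_pos (hpos i) hN).le _) ?_).trans_eq scale.symm
  exact det_truncPow_nonneg (.inl ⟨N, rfl⟩)
    (fun i j hij => neg_lt_neg (div_lt_div_of_pos_left hN (hpos i) (hx hij))) hy

theorem det_exp_mul_nonneg {m : ℕ} {x y : Fin m → ℝ} (hx : StrictMono x) (hy : StrictMono y) :
    0 ≤ (Matrix.of fun i j => Real.exp (x i * y j)).det := by
  obtain ⟨c, hc⟩ := (finite_range x).bddBelow
  have hc (i) : c ≤ x i := hc (mem_range_self i)
  have factor (i j) : Real.exp (x i * y j) =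
      Real.exp ((c - 1) * y j) * Real.exp ((x i - (c - 1)) * y j) := by
    rw [← Real.exp_add]
    congr 1
    ring
  have shifted : 0 ≤ (Matrix.of fun i j => Real.exp ((x i - (c - 1)) * y j)).det :=
    det_exp_mul_nonneg_of_pos (fun i j hij => sub_lt_sub_right (hx hij) _) hy fun i => by
      linarith [hc i]
  have scale := Matrix.det_mul_row (fun j => Real.exp ((c - 1) * y j))
    (Matrix.of fun i j => Real.exp ((x i - (c - 1)) * y j))
  simp only [factor]
  exact (mul_nonneg (Finset.prod_nonneg fun j _ => (Real.exp_pos _).le) shifted).trans_eq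
    scale.symm

/-! ### Derivatives of `l ↦ exp (-t l ^ α)` -/

/-- The polynomials `P k` with `(-d/dl)^k exp (-t l ^ α) = l ^ (-k) exp (-w) (P k)(w)`, where
`w = t l ^ α`. -/
noncomputable def stablePoly (α : ℝ) : ℕ → Polynomial ℝ
  | 0 => 1
  | k + 1 => Polynomial.C (k : ℝ) * stablePoly α k +
      Polynomial.C α * (Polynomial.X * stablePoly α k) -
      Polynomial.C α * (Polynomial.X * (stablePoly α k).derivative)

/-- The `k`-th derivative of `l ↦ exp (-t l ^ α)`, up to the sign `(-1) ^ k`. It is the `k`-th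
moment of `x ↦ p t x * exp (-l x)` for the positive `α`-stable kernel `p`. -/
noncomputable def stableMoment (α : ℝ) (k : ℕ) (t l : ℝ) : ℝ :=
  (l ^ k)⁻¹ * (Real.exp (-(t * l ^ α)) * (stablePoly α k).eval (t * l ^ α))

theorem coeff_stablePoly_succ (α : ℝ) (k j : ℕ) :
    (stablePoly α (k + 1)).coeff j = (k - α * j) * (stablePoly α k).coeff j +
      α * (Polynomial.X * stablePoly α k).coeff j := by
  rcases j with _ | j
  · simp [stablePoly]
  · simp only [stablePoly, Polynomial.coeff_sub, Polynomial.coeff_add, Polynomial.coeff_C_mul,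
      Polynomial.coeff_X_mul, Polynomial.coeff_derivative]
    push_cast
    ring

theorem coeff_stablePoly_of_lt (α : ℝ) {k j : ℕ} (h : k < j) : (stablePoly α k).coeff j = 0 := by
  obtain ⟨j, rfl⟩ := Nat.exists_eq_succ_of_ne_zero (Nat.ne_zero_of_lt h)
  induction k generalizing j with
  | zero => simp [stablePoly, Polynomial.coeff_one]
  | succ k ih =>
    obtain ⟨j, rfl⟩ := Nat.exists_eq_succ_of_ne_zero (n := j) (by omega)
    rw [coeff_stablePoly_succ, Polynomial.coeff_X_mul, ih _ (by omega), ih _ (by omega), mul_zero,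
      mul_zero, add_zero]

section StableMoment

variable {α : ℝ}

theorem coeff_stablePoly_nonneg (hα0 : 0 ≤ α) (hα1 : α ≤ 1) (k j : ℕ) :
    0 ≤ (stablePoly α k).coeff j := by
  induction k generalizing j with
  | zero =>
    rw [stablePoly, Polynomial.coeff_one]
    split_ifs <;> norm_num
  | succ k ih =>
    rw [coeff_stablePoly_succ]
    refine add_nonneg ?_ (mul_nonneg hα0 ?_)
    · rcases lt_or_ge k j with h | h
      · rw [coeff_stablePoly_of_lt α h, mul_zero]
      · have : (j : ℝ) ≤ k := Nat.cast_le.2 h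
        exact mul_nonneg (by nlinarith [j.cast_nonneg (α := ℝ)]) (ih j)
    · cases j
      · rw [Polynomial.coeff_X_mul_zero]
      · rw [Polynomial.coeff_X_mul]
        exact ih _

theorem stableMoment_nonneg (hα0 : 0 ≤ α) (hα1 : α ≤ 1) (k : ℕ) {t l : ℝ} (ht : 0 ≤ t)
    (hl : 0 ≤ l) : 0 ≤ stableMoment α k t l := by
  refine mul_nonneg (by positivity) (mul_nonneg (Real.exp_pos _).le ?_)
  rw [Polynomial.eval_eq_sum_range]
  exact Finset.sum_nonneg fun j _ => mul_nonneg (coeff_stablePoly_nonneg hα0 hα1 k j)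
    (pow_nonneg (mul_nonneg ht (Real.rpow_nonneg hl _)) _)

theorem stableMoment_zero (α t l : ℝ) : stableMoment α 0 t l = Real.exp (-(t * l ^ α)) := by
  simp [stableMoment, stablePoly]

theorem stableMoment_one (α t l : ℝ) :
    stableMoment α 1 t l = l⁻¹ * (Real.exp (-(t * l ^ α)) * (α * (t * l ^ α))) := by
  simp [stableMoment, stablePoly]

theorem stableMoment_two (α t l : ℝ) :
    stableMoment α 2 t l = (l ^ 2)⁻¹ * (α * (t * l ^ α)) *
      (Real.exp (-(t * l ^ α)) * (1 - α + α * (t * l ^ α))) := by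
  simp only [stableMoment, stablePoly, Nat.cast_zero, Nat.cast_one, map_zero, map_one, zero_mul,
    one_mul, mul_one, zero_add, Polynomial.derivative_one, mul_zero, sub_zero,
    Polynomial.derivative_mul, Polynomial.derivative_C, Polynomial.derivative_X,
    Polynomial.eval_sub, Polynomial.eval_add, Polynomial.eval_mul, Polynomial.eval_C,
    Polynomial.eval_X]
  ring

theorem hasDerivAt_stableMoment (α : ℝ) (k : ℕ) (t : ℝ) {l : ℝ} (hl : 0 < l) :
    HasDerivAt (stableMoment α k t) (-stableMoment α (k + 1) t l) l := by
  have hw : HasDerivAt (fun l : ℝ => t * l ^ α) (t * (α * (l ^ α / l))) l :=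
    Real.rpow_sub_one hl.ne' α ▸ (Real.hasDerivAt_rpow_const (Or.inl hl.ne')).const_mul t
  have hpow : HasDerivAt (fun l : ℝ => (l ^ k)⁻¹) (-(k * (l ^ k)⁻¹ / l)) l := by
    have h := hasDerivAt_zpow (-k) l (.inl hl.ne')
    simp only [zpow_neg, zpow_natCast, zpow_sub_one₀ hl.ne'] at h
    exact h.congr_deriv (by push_cast; ring)
  have hpoly := ((stablePoly α k).hasDerivAt (t * l ^ α)).comp l hw
  refine (hpow.mul (hw.neg.exp.mul hpoly)).congr_deriv ?_
  simp only [stableMoment, stablePoly, Polynomial.eval_sub, Polynomial.eval_add,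
    Polynomial.eval_mul, Polynomial.eval_C, Polynomial.eval_X, Function.comp, Pi.mul_apply,
    Pi.neg_apply]
  field_simp
  ring

theorem stableMoment_antitoneOn (hα0 : 0 ≤ α) (hα1 : α ≤ 1) (k : ℕ) {t : ℝ} (ht : 0 ≤ t) :
    AntitoneOn (stableMoment α k t) (Ioi 0) := by
  refine antitoneOn_of_hasDerivWithinAt_nonpos (convex_Ioi 0)
    (fun l hl => (hasDerivAt_stableMoment α k t hl).continuousAt.continuousWithinAt)
    (fun l hl => (hasDerivAt_stableMoment α k t (interior_subset hl)).hasDerivWithinAt)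
    fun l hl => neg_nonpos.2 (stableMoment_nonneg hα0 hα1 _ ht (mem_Ioi.1 (interior_subset hl)).le)

@[fun_prop]
theorem continuous_stableMoment (α : ℝ) (k : ℕ) (l : ℝ) :
    Continuous fun t => stableMoment α k t l := by
  unfold stableMoment
  fun_prop

theorem integrableOn_truncPow_mul_exp_mul_eval {a t c : ℝ} (ha : 0 ≤ a) (ht : 0 ≤ t)
    (hc : 0 < c) (P : Polynomial ℝ) :
    IntegrableOn (fun s => truncPow a (s - t) * (Real.exp (-(s * c)) * P.eval (s * c)))
      (Ioi 0) := by
  induction P using Polynomial.induction_on' with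
  | add p q hp hq =>
    simp only [Polynomial.eval_add, mul_add]
    exact hp.add hq
  | monomial j b =>
    have gamma := (integrableOn_rpow_mul_exp_neg_mul_rpow (p := 1) (s := a + j) (b := c)
      (by linarith [j.cast_nonneg (α := ℝ)]) one_pos hc).const_mul (|b| * c ^ j)
    refine gamma.mono' (Measurable.aestronglyMeasurable (by fun_prop)) ?_
    filter_upwards [ae_restrict_mem measurableSet_Ioi] with s (hs : 0 < s)
    have hle : truncPow a (s - t) ≤ s ^ a := by
      rcases lt_or_ge 0 (s - t) with h | h
      · rw [truncPow_of_pos h]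
        exact Real.rpow_le_rpow h.le (sub_le_self s ht) ha
      · exact (truncPow_of_nonpos h).trans_le (Real.rpow_nonneg hs.le a)
    rw [Polynomial.eval_monomial, Real.norm_eq_abs, abs_mul, abs_of_nonneg (truncPow_nonneg _ _)]
    calc truncPow a (s - t) * |Real.exp (-(s * c)) * (b * (s * c) ^ j)|
        ≤ s ^ a * |Real.exp (-(s * c)) * (b * (s * c) ^ j)| := by gcongr
      _ = |b| * c ^ j * (s ^ (a + j) * Real.exp (-c * s ^ (1 : ℝ))) := by
          rw [abs_mul, Real.abs_exp, abs_mul, abs_of_nonneg (by positivity : 0 ≤ (s * c) ^ j),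
            Real.rpow_add hs, Real.rpow_natCast, Real.rpow_one, mul_pow, neg_mul, mul_comm c s]
          ring

theorem integrableOn_truncPow_mul_stableMoment (α : ℝ) {a t l : ℝ} (ha : 0 ≤ a) (k : ℕ)
    (ht : 0 ≤ t) (hl : 0 < l) :
    IntegrableOn (fun s => truncPow a (s - t) * stableMoment α k s l) (Ioi 0) := by
  refine ((integrableOn_truncPow_mul_exp_mul_eval ha ht (Real.rpow_pos_of_pos hl α)
    (stablePoly α k)).const_mul (l ^ k)⁻¹).congr (.of_forall fun s => ?_)
  simp only [stableMoment]
  ring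

theorem integral_truncPow_sub_mul (a : ℝ) {t : ℝ} (ht : 0 ≤ t) (f : ℝ → ℝ) :
    ∫ s in Ioi (0 : ℝ), truncPow a (s - t) * f s = ∫ s in Ioi (0 : ℝ), s ^ a * f (s + t) := by
  rw [setIntegral_eq_integral_of_forall_compl_eq_zero fun s hs => by
      rw [truncPow_of_nonpos (by linarith [notMem_Ioi.1 hs]), zero_mul],
    ← integral_add_right_eq_self _ t, ← integral_indicator measurableSet_Ioi]
  refine integral_congr_ae (.of_forall fun s => ?_)
  simp only [add_sub_cancel_right, truncPow, indicator_mul_left]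

theorem integral_truncPow_mul_exp {a t c : ℝ} (ha : -1 < a) (ht : 0 ≤ t) (hc : 0 < c) :
    ∫ s in Ioi (0 : ℝ), truncPow a (s - t) * Real.exp (-(s * c)) =
      Real.exp (-(t * c)) * ((1 / c) ^ (a + 1) * Real.Gamma (a + 1)) := by
  rw [integral_truncPow_sub_mul a ht,
    ← Real.integral_rpow_mul_exp_neg_mul_Ioi (neg_lt_iff_pos_add.1 ha) hc, ← integral_const_mul]
  refine setIntegral_congr_fun measurableSet_Ioi fun s _ => ?_
  rw [show -((s + t) * c) = -(t * c) + -(c * s) by ring, Real.exp_add, add_sub_cancel_right]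
  ring

theorem hasDerivAt_integral_truncPow_mul_stableMoment (hα0 : 0 ≤ α) (hα1 : α ≤ 1) {a t l : ℝ}
    (ha : 0 ≤ a) (k : ℕ) (ht : 0 ≤ t) (hl : 0 < l) :
    HasDerivAt (fun l => ∫ s in Ioi (0 : ℝ), truncPow a (s - t) * stableMoment α k s l)
      (-∫ s in Ioi (0 : ℝ), truncPow a (s - t) * stableMoment α (k + 1) s l) l := by
  have deriv_under_integral := (hasDerivAt_integral_of_dominated_loc_of_deriv_le (𝕜 := ℝ)
    (μ := volume.restrict (Ioi (0 : ℝ))) (x₀ := l) (s := Ioi (l / 2))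
    (F := fun l s => truncPow a (s - t) * stableMoment α k s l)
    (F' := fun l s => truncPow a (s - t) * -stableMoment α (k + 1) s l)
    (bound := fun s => truncPow a (s - t) * stableMoment α (k + 1) s (l / 2))
    (Ioi_mem_nhds (half_lt_self hl))
    (.of_forall fun l => Measurable.aestronglyMeasurable (by fun_prop))
    (integrableOn_truncPow_mul_stableMoment α ha k ht hl)
    (Measurable.aestronglyMeasurable (by fun_prop)) ?_
    (integrableOn_truncPow_mul_stableMoment α ha (k + 1) ht (half_pos hl))
    (.of_forall fun s l' hl' =>
      (hasDerivAt_stableMoment α k s ((half_pos hl).trans hl')).const_mul _)).2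
  · simpa only [mul_neg, integral_neg] using deriv_under_integral
  · filter_upwards [ae_restrict_mem measurableSet_Ioi] with s (hs : 0 < s) l' hl'
    have hl0 : 0 < l' := (half_pos hl).trans hl'
    rw [norm_mul, norm_neg, Real.norm_of_nonneg (truncPow_nonneg _ _),
      Real.norm_of_nonneg (stableMoment_nonneg hα0 hα1 _ hs.le hl0.le)]
    exact mul_le_mul_of_nonneg_left (stableMoment_antitoneOn hα0 hα1 _ hs.le (half_pos hl) hl0
      (le_of_lt hl')) (truncPow_nonneg _ _)

/-- Up to a factor, each derivative of `exp (-t l ^ α)` in `l` is a fractional integral in `t` of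
the preceding one. -/
theorem stableMoment_succ (hα : 2 ≤ α⁻¹) (k : ℕ) {t l : ℝ} (ht : 0 ≤ t) (hl : 0 < l) :
    stableMoment α (k + 1) t l = α / Real.Gamma (α⁻¹ - 1) * t *
      ∫ s in Ioi (0 : ℝ), truncPow (α⁻¹ - 2) (s - t) * stableMoment α k s l := by
  have hα0 : 0 < α := inv_pos.1 (two_pos.trans_le hα)
  have hα1 : α ≤ 1 := (one_le_inv₀ hα0).1 (one_le_two.trans hα)
  induction k generalizing l with
  | zero =>
    have gamma_ne : Real.Gamma (α⁻¹ - 1) ≠ 0 := (Real.Gamma_pos_of_pos (by linarith)).ne'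
    have rpow_simp : (1 / l ^ α) ^ (α⁻¹ - 1) = l⁻¹ * l ^ α := by
      rw [one_div, ← Real.rpow_neg hl.le, ← Real.rpow_mul hl.le,
        show -α * (α⁻¹ - 1) = -1 + α by field_simp; ring, Real.rpow_add hl, Real.rpow_neg_one]
    simp only [stableMoment_zero, zero_add]
    rw [integral_truncPow_mul_exp (by linarith) ht (Real.rpow_pos_of_pos hl α), stableMoment_one,
      show α⁻¹ - 2 + 1 = α⁻¹ - 1 by ring, rpow_simp]
    generalize Real.Gamma (α⁻¹ - 1) = G at gamma_ne
    field_simp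
  | succ k ih =>
    have deriv_integral := (hasDerivAt_integral_truncPow_mul_stableMoment hα0.le hα1
      (sub_nonneg.2 hα) k ht hl).const_mul (α / Real.Gamma (α⁻¹ - 1) * t)
    have deriv_eq := (hasDerivAt_stableMoment α (k + 1) t hl).unique
      (deriv_integral.congr_of_eventuallyEq (by
        filter_upwards [Ioi_mem_nhds hl] with l' hl' using ih hl'))
    rwa [mul_neg, neg_inj] at deriv_eq

theorem det_stableMoment_nonneg (hα : 2 ≤ α⁻¹) {m : ℕ}
    (hm : (∃ k : ℕ, k = α⁻¹) ∨ (m : ℝ) ≤ α⁻¹) (k : ℕ) {t l : Fin m → ℝ} (ht : StrictMono t)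
    (hl : StrictAnti l) (ht0 : ∀ i, 0 ≤ t i) (hl0 : ∀ j, 0 < l j) :
    0 ≤ (Matrix.of fun i j => stableMoment α k (t i) (l j)).det := by
  have hα0 : 0 < α := inv_pos.1 (two_pos.trans_le hα)
  induction k generalizing t with
  | zero =>
    have h := det_exp_mul_nonneg ht (y := fun j => -l j ^ α) fun i j hij =>
      neg_lt_neg (Real.rpow_lt_rpow (hl0 j).le (hl hij) hα0)
    simpa only [stableMoment_zero, mul_neg] using h
  | succ k ih =>
    have hexp : (∃ k : ℕ, (k : ℝ) = α⁻¹ - 2) ∨ (m : ℝ) - 2 ≤ α⁻¹ - 2 := by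
      refine hm.imp ?_ fun h => sub_le_sub_right h 2
      rintro ⟨k, hk⟩
      have : 2 ≤ k := by exact_mod_cast hk ▸ hα
      exact ⟨k - 2, by rw [Nat.cast_sub this, hk, Nat.cast_ofNat]⟩
    have gamma_pos : 0 < Real.Gamma (α⁻¹ - 1) := Real.Gamma_pos_of_pos (by linarith)
    have scale := Matrix.det_mul_column (fun i => α / Real.Gamma (α⁻¹ - 1) * t i)
      (Matrix.of fun i j => ∫ s in Ioi (0 : ℝ),
        truncPow (α⁻¹ - 2) (s - t i) * stableMoment α k s (l j))
    simp only [stableMoment_succ hα k (ht0 _) (hl0 _)]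
    refine (mul_nonneg (Finset.prod_nonneg fun i _ =>
      mul_nonneg (div_pos hα0 gamma_pos).le (ht0 i)) ?_).trans_eq scale.symm
    exact det_integral_mul_nonneg (L := fun j s => stableMoment α k s (l j))
      (ae_restrict_mem measurableSet_Ioi)
      (fun i j => integrableOn_truncPow_mul_stableMoment α (sub_nonneg.2 hα) k (ht0 i) (hl0 j))
      (fun s hs _ => det_truncPow_nonneg hexp ht hs) fun s hs hs0 =>
        ih hs fun i => (mem_Ioi.1 (hs0 i)).le

end StableMoment

/-! ### Laplace transforms -/

/-- The Laplace integral of `f` converges absolutely at every positive point. -/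
def LaplaceIntegrable (f : ℝ → ℝ) : Prop :=
  ∀ ⦃l : ℝ⦄, 0 < l → IntegrableOn (fun x => f x * Real.exp (-(l * x))) (Ioi 0)

/-- The one-sided Laplace transform of `f`. -/
noncomputable def laplaceTransform (f : ℝ → ℝ) (l : ℝ) : ℝ :=
  ∫ x in Ioi (0 : ℝ), f x * Real.exp (-(l * x))

section LaplaceTransform

variable {α t : ℝ} {f : ℝ → ℝ}

theorem LaplaceIntegrable.pow_mul (hf : LaplaceIntegrable f) (k : ℕ) :
    LaplaceIntegrable fun x => x ^ k * f x := by
  intro l hl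
  have exp_split (x : ℝ) :
      Real.exp (-(l * x)) = Real.exp (-(l / 2 * x)) * Real.exp (-(l / 2 * x)) := by
    rw [← Real.exp_add]
    ring_nf
  have pow_le {x : ℝ} (hx : 0 ≤ x) : x ^ k * Real.exp (-(l / 2 * x)) ≤ k ! / (l / 2) ^ k := by
    have h := Real.pow_div_factorial_le_exp (l / 2 * x) (by positivity) k
    rw [mul_pow, div_le_iff₀ (by positivity)] at h
    rw [Real.exp_neg, ← div_eq_mul_inv, div_le_div_iff₀ (Real.exp_pos _) (by positivity)]
    linarith
  refine ((hf (half_pos hl)).norm.const_mul (k ! / (l / 2) ^ k)).mono' ?_ ?_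
  · simp only [mul_assoc]
    exact (continuous_pow k).aestronglyMeasurable.mul (hf hl).aestronglyMeasurable
  · filter_upwards [ae_restrict_mem measurableSet_Ioi] with x (hx : 0 < x)
    rw [exp_split, norm_mul, norm_mul, norm_mul, norm_mul, Real.norm_of_nonneg (pow_nonneg hx.le k),
      Real.norm_of_nonneg (Real.exp_pos _).le]
    calc x ^ k * ‖f x‖ * (Real.exp (-(l / 2 * x)) * Real.exp (-(l / 2 * x)))
        = x ^ k * Real.exp (-(l / 2 * x)) * (‖f x‖ * Real.exp (-(l / 2 * x))) := by ring
      _ ≤ k ! / (l / 2) ^ k * (‖f x‖ * Real.exp (-(l / 2 * x))) := by gcongr; exact pow_le hx.le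

theorem LaplaceIntegrable.hasDerivAt_laplaceTransform (hf : LaplaceIntegrable f) {l : ℝ}
    (hl : 0 < l) :
    HasDerivAt (laplaceTransform f) (-laplaceTransform (fun x => x * f x) l) l := by
  have hxf : LaplaceIntegrable fun x => x * f x := by simpa only [pow_one] using hf.pow_mul 1
  have deriv_under_integral := (hasDerivAt_integral_of_dominated_loc_of_deriv_le (𝕜 := ℝ)
    (μ := volume.restrict (Ioi (0 : ℝ))) (x₀ := l) (s := Ioi (l / 2))
    (F := fun l x => f x * Real.exp (-(l * x)))
    (F' := fun l x => -(x * f x * Real.exp (-(l * x))))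
    (bound := fun x => ‖x * f x * Real.exp (-(l / 2 * x))‖)
    (Ioi_mem_nhds (half_lt_self hl)) ?_ (hf hl) (hxf hl).aestronglyMeasurable.neg ?_
    (hxf (half_pos hl)).norm (.of_forall fun x l' _ => ?_)).2
  · rwa [integral_neg] at deriv_under_integral
  · filter_upwards [Ioi_mem_nhds hl] with l' hl'
    exact (hf hl').aestronglyMeasurable
  · filter_upwards [ae_restrict_mem measurableSet_Ioi] with x (hx : 0 < x) l' (hl' : l / 2 < l')
    rw [norm_neg, norm_mul, norm_mul _ (Real.exp _), Real.norm_of_nonneg (Real.exp_pos _).le,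
      Real.norm_of_nonneg (Real.exp_pos _).le]
    gcongr
  · refine ((((hasDerivAt_id l').mul_const x).neg.exp).const_mul (f x)).congr_deriv ?_
    simp only [id, Pi.neg_apply]
    ring

theorem LaplaceIntegrable.laplaceTransform_pow_mul_eq_stableMoment (hf : LaplaceIntegrable f)
    (hL : ∀ l, 0 < l → laplaceTransform f l = Real.exp (-(t * l ^ α))) (k : ℕ) {l : ℝ}
    (hl : 0 < l) : laplaceTransform (fun x => x ^ k * f x) l = stableMoment α k t l := by
  induction k generalizing l with
  | zero => simpa only [pow_zero, one_mul, stableMoment_zero] using hL l hl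
  | succ k ih =>
    have deriv_eq := ((hf.pow_mul k).hasDerivAt_laplaceTransform hl).unique
      ((hasDerivAt_stableMoment α k t hl).congr_of_eventuallyEq (by
        filter_upwards [Ioi_mem_nhds hl] with l' hl' using ih hl'))
    simp only [← mul_assoc, ← pow_succ'] at deriv_eq
    exact neg_inj.1 deriv_eq

/-! ### The Post–Widder inversion formula -/

theorem negMulLog_lt_exp_neg_one {y : ℝ} (hy : 0 ≤ y) (hne : y ≠ Real.exp (-1)) :
    Real.negMulLog y < Real.exp (-1) := by
  rcases hy.eq_or_lt with rfl | hy
  · rw [Real.negMulLog_zero]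
    exact Real.exp_pos _
  · have hz : -Real.log y - 1 ≠ 0 := fun h => hne (by
      rw [← Real.exp_log hy, show Real.log y = -1 by linarith])
    have h := Real.add_one_lt_exp hz
    rw [sub_add_cancel, sub_eq_add_neg, Real.exp_add, Real.exp_neg, Real.exp_log hy] at h
    calc Real.negMulLog y = y * -Real.log y := by rw [Real.negMulLog, neg_mul_comm]
      _ < y * (y⁻¹ * Real.exp (-1)) := by gcongr
      _ = Real.exp (-1) := mul_inv_cancel_left₀ hy.ne' _

theorem hasDerivAt_exp_neg_div (x y : ℝ) :
    HasDerivAt (fun y => Real.exp (-(y / x))) (-(x⁻¹ * Real.exp (-(y / x)))) y :=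
  ((hasDerivAt_id y).div_const x).neg.exp.congr_deriv (by simp [div_eq_mul_inv, mul_comm])

section ChangeOfVariables

variable {x : ℝ} (hx : 0 < x)
include hx

theorem image_exp_neg_div : (fun y => Real.exp (-(y / x))) '' Ioi 0 = Ioo 0 1 := by
  ext v
  constructor
  · rintro ⟨y, hy, rfl⟩
    exact ⟨Real.exp_pos _, Real.exp_lt_one_iff.2 (neg_neg_of_pos (div_pos hy hx))⟩
  · rintro ⟨h0, h1⟩
    refine ⟨-(x * Real.log v), neg_pos.2 (mul_neg_of_pos_of_neg hx (Real.log_neg h0 h1)), ?_⟩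
    simp only [neg_div, neg_neg, mul_div_cancel_left₀ _ hx.ne', Real.exp_log h0]

theorem injective_exp_neg_div : Function.Injective fun y => Real.exp (-(y / x)) := fun _ _ h =>
  (div_left_inj' hx.ne').1 (neg_inj.1 (Real.exp_injective h))

theorem abs_deriv_exp_neg_div (y : ℝ) :
    |(-(x⁻¹ * Real.exp (-(y / x))))| = x⁻¹ * Real.exp (-(y / x)) := by
  rw [abs_neg, abs_of_pos (by positivity)]

theorem integrableOn_Icc_iff_comp_exp_neg_div {h : ℝ → ℝ} :
    IntegrableOn h (Icc 0 1) ↔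
      IntegrableOn (fun y => x⁻¹ * Real.exp (-(y / x)) * h (Real.exp (-(y / x)))) (Ioi 0) := by
  rw [integrableOn_Icc_iff_integrableOn_Ioo, ← image_exp_neg_div hx,
    integrableOn_image_iff_integrableOn_abs_deriv_smul measurableSet_Ioi
      (fun y _ => (hasDerivAt_exp_neg_div x y).hasDerivWithinAt) (injective_exp_neg_div hx).injOn]
  simp only [abs_deriv_exp_neg_div hx, smul_eq_mul]

theorem integral_Icc_eq_integral_comp_exp_neg_div (h : ℝ → ℝ) :
    ∫ v in Icc (0 : ℝ) 1, h v =
      ∫ y in Ioi (0 : ℝ), x⁻¹ * Real.exp (-(y / x)) * h (Real.exp (-(y / x))) := by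
  rw [integral_Icc_eq_integral_Ioc, integral_Ioc_eq_integral_Ioo, ← image_exp_neg_div hx,
    integral_image_eq_integral_abs_deriv_smul measurableSet_Ioi
      (fun y _ => (hasDerivAt_exp_neg_div x y).hasDerivWithinAt) (injective_exp_neg_div hx).injOn]
  simp only [abs_deriv_exp_neg_div hx, smul_eq_mul]

theorem integral_negMulLog_pow_mul (f : ℝ → ℝ) (n : ℕ) :
    ∫ v in Icc (0 : ℝ) 1, Real.negMulLog v ^ n * f (-(x * Real.log v)) =
      (x ^ (n + 1))⁻¹ * laplaceTransform (fun y => y ^ n * f y) ((n + 1) / x) := by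
  rw [integral_Icc_eq_integral_comp_exp_neg_div hx, laplaceTransform, ← integral_const_mul]
  refine setIntegral_congr_fun measurableSet_Ioi fun y _ => ?_
  have exp_eq : Real.exp (-((n + 1) / x * y)) = Real.exp (-(y / x)) * Real.exp (-(y / x)) ^ n := by
    rw [← Real.exp_nat_mul, ← Real.exp_add]
    congr 1
    field_simp
    ring
  have arg_eq : -(x * -(y / x)) = y := by field_simp
  simp only [exp_eq, Real.negMulLog, Real.log_exp, arg_eq, neg_mul_neg, mul_pow, div_pow, pow_succ,
    mul_inv]
  ring

theorem integrableOn_comp_neg_mul_log (hf : LaplaceIntegrable f) :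
    IntegrableOn (fun v => f (-(x * Real.log v))) (Icc 0 1) := by
  rw [integrableOn_Icc_iff_comp_exp_neg_div hx]
  refine ((hf (inv_pos.2 hx)).const_mul x⁻¹).congr (.of_forall fun y => ?_)
  have arg_eq : -(x * -(y / x)) = y := by field_simp
  simp only [Real.log_exp, arg_eq, ← div_eq_inv_mul]
  ring

end ChangeOfVariables

theorem integral_negMulLog_pow (n : ℕ) :
    ∫ v in Icc (0 : ℝ) 1, Real.negMulLog v ^ n = n ! / (n + 1 : ℝ) ^ (n + 1) := by
  have h := integral_negMulLog_pow_mul one_pos (fun _ => 1) n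
  have gamma := Real.integral_rpow_mul_exp_neg_mul_Ioi (a := n + 1) (r := n + 1)
    (by positivity) (by positivity)
  simp only [add_sub_cancel_right, Real.rpow_natCast, Real.Gamma_nat_eq_factorial] at gamma
  simp only [laplaceTransform, mul_one, div_one, one_pow, inv_one, one_mul, gamma] at h
  rw [h, ← Nat.cast_succ, Real.rpow_natCast, one_div_pow, one_div_mul_eq_div]

/-- Post–Widder inversion. After the substitution `v = exp (-y / x)` the right-hand sides are the
averages of `f (-x log v)` with respect to the weights `(-v log v) ^ n` on `[0, 1]`, which
concentrate at the maximum point `v = e⁻¹`, corresponding to `y = x`. -/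
theorem LaplaceIntegrable.tendsto_postWidder (hf : LaplaceIntegrable f) {x : ℝ} (hx : 0 < x)
    (hc : ContinuousAt f x) :
    Tendsto (fun n : ℕ => ((n + 1) / x) ^ (n + 1) / n ! *
      laplaceTransform (fun y => y ^ n * f y) ((n + 1) / x)) atTop (𝓝 (f x)) := by
  have max_value : Real.negMulLog (Real.exp (-1)) = Real.exp (-1) := by simp [Real.negMulLog]
  have arg_max : -(x * Real.log (Real.exp (-1))) = x := by simp
  have hcont : ContinuousAt (fun v => f (-(x * Real.log v))) (Real.exp (-1)) :=
    ContinuousAt.comp (g := f) (by rwa [arg_max])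
      ((Real.continuousAt_log (Real.exp_pos _).ne').const_mul x).neg
  have concentration := tendsto_setIntegral_pow_smul_of_unique_maximum_of_isCompact_of_integrableOn
    (μ := volume) (g := fun v => f (-(x * Real.log v))) (x₀ := Real.exp (-1)) isCompact_Icc
    Real.continuous_negMulLog.continuousOn
    (fun v hv hne => (negMulLog_lt_exp_neg_one hv.1 hne).trans_eq max_value.symm)
    (fun v hv => Real.negMulLog_nonneg hv.1 hv.2) ((Real.exp_pos _).trans_eq max_value.symm)
    (by
      rw [interior_Icc, closure_Ioo zero_ne_one]
      exact ⟨(Real.exp_pos _).le, Real.exp_le_one_iff.2 (by norm_num)⟩)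
    (integrableOn_comp_neg_mul_log hx hf) hcont.continuousWithinAt
  simp only [arg_max, smul_eq_mul, integral_negMulLog_pow_mul hx, integral_negMulLog_pow]
    at concentration
  refine concentration.congr fun n => ?_
  rw [inv_div, div_pow]
  field_simp

theorem LaplaceIntegrable.tendsto_stableMoment (hf : LaplaceIntegrable f)
    (hL : ∀ l, 0 < l → laplaceTransform f l = Real.exp (-(t * l ^ α))) {x : ℝ} (hx : 0 < x)
    (hc : ContinuousAt f x) :
    Tendsto (fun n : ℕ => ((n + 1) / x) ^ (n + 1) / n ! * stableMoment α n t ((n + 1) / x))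
      atTop (𝓝 (f x)) :=
  (hf.tendsto_postWidder hx hc).congr fun n => by
    rw [hf.laplaceTransform_pow_mul_eq_stableMoment hL n (by positivity)]

theorem LaplaceIntegrable.nonneg_of_laplaceTransform_eq (hf : LaplaceIntegrable f)
    (hα0 : 0 ≤ α) (hα1 : α ≤ 1) (ht : 0 ≤ t)
    (hL : ∀ l, 0 < l → laplaceTransform f l = Real.exp (-(t * l ^ α))) {x : ℝ} (hx : 0 < x)
    (hc : ContinuousAt f x) : 0 ≤ f x :=
  ge_of_tendsto' (hf.tendsto_stableMoment hL hx hc) fun n =>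
    mul_nonneg (by positivity) (stableMoment_nonneg hα0 hα1 n ht (by positivity))

end LaplaceTransform

/-! ### Sufficiency -/

section Sufficiency

variable {α : ℝ} {p : ℝ → ℝ → ℝ}

theorem IsPositiveStableKernel.tendsto_stableMoment (hp : IsPositiveStableKernel α p) {t : ℝ}
    (ht : 0 < t) {x : ℝ} (hx : 0 < x) :
    Tendsto (fun n : ℕ => ((n + 1) / x) ^ (n + 1) / n ! * stableMoment α n t ((n + 1) / x))
      atTop (𝓝 (p t x)) :=
  LaplaceIntegrable.tendsto_stableMoment (hp.integrableOn t ht) (hp.laplace t ht) hx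
    ((hp.continuousOn t ht).continuousAt (Ioi_mem_nhds hx))

theorem IsPositiveStableKernel.isTotallyPositive (hp : IsPositiveStableKernel α p) (hα : 2 ≤ α⁻¹)
    {n : ℕ} (hn : (∃ k : ℕ, k = α⁻¹) ∨ (n : ℝ) ≤ α⁻¹) : IsTotallyPositive n (Ioi 0) p := by
  intro m _ hmn t x ht hx ht0 hx0
  have hx0 (j) : 0 < x j := hx0 j
  have hlim : Tendsto (fun k : ℕ => (Matrix.of fun i j => ((k + 1) / x j) ^ (k + 1) / k ! *
      stableMoment α k (t i) ((k + 1) / x j)).det) atTop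
      (𝓝 (Matrix.of fun i j => p (t i) (x j)).det) :=
    (continuous_id.matrix_det.tendsto _).comp <| tendsto_pi_nhds.2 fun i =>
      tendsto_pi_nhds.2 fun j => hp.tendsto_stableMoment (ht0 i) (hx0 j)
  refine ge_of_tendsto' hlim fun k => ?_
  have scale := Matrix.det_mul_row (fun j => ((k + 1) / x j) ^ (k + 1) / (k ! : ℝ))
    (Matrix.of fun i j => stableMoment α k (t i) ((k + 1) / x j))
  refine (mul_nonneg (Finset.prod_nonneg fun j _ => ?_) ?_).trans_eq scale.symm
  · have := hx0 j
    positivity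
  · exact det_stableMoment_nonneg hα (hn.imp_right (Nat.cast_le.2 hmn).trans) k ht
      (fun i j hij => div_lt_div_of_pos_left (by positivity) (hx0 i) (hx hij))
      (fun i => le_of_lt (ht0 i)) fun j => div_pos (by positivity) (hx0 j)

end Sufficiency

/-! ### Complex inversion of the Laplace transform -/

theorem integral_vertical_line_eq {g : ℂ → ℂ} {w : ℝ → ℝ} {a b : ℝ}
    (hg : DifferentiableOn ℂ g {z | z.re ∈ uIcc a b}) (hgw : ∀ z, z.re ∈ uIcc a b → ‖g z‖ ≤ w z.im)
    (hw : Integrable w) (hw0 : Tendsto w (cocompact ℝ) (𝓝 0)) :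
    ∫ y : ℝ, g (a + y * Complex.I) = ∫ y : ℝ, g (b + y * Complex.I) := by
  have integrable_line {c : ℝ} (hc : c ∈ uIcc a b) :
      Integrable fun y : ℝ => g (c + y * Complex.I) := by
    refine hw.mono' (Continuous.aestronglyMeasurable (continuousOn_univ.1 ?_))
      (.of_forall fun y => by simpa using hgw (c + y * Complex.I) (by simpa using hc))
    exact hg.continuousOn.comp (by fun_prop) fun y _ => by simpa using hc
  have vertical {c : ℝ} (hc : c ∈ uIcc a b) : Tendsto (fun T : ℝ => ∫ y in -T..T,
      g (c + y * Complex.I)) atTop (𝓝 (∫ y : ℝ, g (c + y * Complex.I))) :=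
    intervalIntegral_tendsto_integral (integrable_line hc) tendsto_neg_atTop_atBot tendsto_id
  have horizontal {s : ℝ → ℝ} (hs : Tendsto s atTop (cocompact ℝ)) :
      Tendsto (fun T => ∫ x in a..b, g (x + s T * Complex.I)) atTop (𝓝 0) := by
    refine squeeze_zero_norm (fun T => intervalIntegral.norm_integral_le_of_norm_le_const
      fun x hx => ?_) (by simpa using (hw0.comp hs).mul_const |b - a|)
    simpa using hgw (x + s T * Complex.I) (by simpa using uIoc_subset_uIcc hx)
  have cauchy (T : ℝ) := Complex.integral_boundary_rect_eq_zero_of_differentiableOn g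
    (a + (-T : ℝ) * Complex.I) (b + T * Complex.I)
    (hg.mono fun z hz => by simpa using (Complex.mem_reProdIm.1 hz).1)
  simp only [Complex.add_re, Complex.add_im, Complex.ofReal_re, Complex.ofReal_im,
    Complex.re_ofReal_mul, Complex.im_ofReal_mul, Complex.I_re, Complex.I_im, mul_zero, mul_one,
    add_zero, zero_add] at cauchy
  have limit := (((horizontal (tendsto_neg_atTop_atBot.mono_right atBot_le_cocompact)).sub
    (horizontal (tendsto_id.mono_right atTop_le_cocompact))).add
    ((vertical right_mem_uIcc).const_smul Complex.I)).sub
    ((vertical left_mem_uIcc).const_smul Complex.I)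
  have boundary_eq := tendsto_nhds_unique (limit.congr cauchy) tendsto_const_nhds
  rw [sub_zero, zero_add, sub_eq_zero, smul_right_inj Complex.I_ne_zero] at boundary_eq
  exact boundary_eq.symm

/-- `F` is holomorphic on the right half-plane and dominated on every vertical line by the same
integrable function `w` vanishing at infinity; this makes the complex inversion formula for the
Laplace transform converge absolutely. -/
structure IsVerticallyDominated (F : ℂ → ℂ) (w : ℝ → ℝ) : Prop where
  differentiableOn : DifferentiableOn ℂ F {z | 0 < z.re}
  norm_le : ∀ z, 0 < z.re → ‖F z‖ ≤ w z.im
  integrable : Integrable w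
  tendsto_zero : Tendsto w (cocompact ℝ) (𝓝 0)

/-- The Bromwich integral of `F`, on the vertical line through `1`. By Cauchy's theorem any other
line in the right half-plane gives the same value when `F` is vertically dominated. -/
noncomputable def inverseLaplace (F : ℂ → ℂ) (x : ℝ) : ℂ :=
  (2 * Real.pi : ℂ)⁻¹ *
    ∫ y : ℝ, Complex.exp (x * (1 + y * Complex.I)) * F (1 + y * Complex.I)

namespace IsVerticallyDominated

variable {F : ℂ → ℂ} {w : ℝ → ℝ} (hF : IsVerticallyDominated F w) {l : ℝ}
include hF

theorem continuous_vertical_line (hl : 0 < l) : Continuous fun y : ℝ => F (l + y * Complex.I) :=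
  continuousOn_univ.1 <|
    hF.differentiableOn.continuousOn.comp (by fun_prop) fun y _ => by simpa using hl

theorem norm_vertical_line_le (hl : 0 < l) (y : ℝ) : ‖F (l + y * Complex.I)‖ ≤ w y := by
  simpa using hF.norm_le (l + y * Complex.I) (by simpa using hl)

theorem integrable_vertical_line (hl : 0 < l) : Integrable fun y : ℝ => F (l + y * Complex.I) :=
  hF.integrable.mono' (hF.continuous_vertical_line hl).aestronglyMeasurable
    (.of_forall (hF.norm_vertical_line_le hl))

theorem inverseLaplace_eq (hl : 0 < l) (x : ℝ) :
    inverseLaplace F x = (2 * Real.pi : ℂ)⁻¹ *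
      ∫ y : ℝ, Complex.exp (x * (l + y * Complex.I)) * F (l + y * Complex.I) := by
  have re_pos {z : ℂ} (hz : z.re ∈ uIcc 1 l) : 0 < z.re := (lt_min one_pos hl).trans_le hz.1
  have shift := integral_vertical_line_eq (g := fun z => Complex.exp (x * z) * F z)
    (a := 1) (b := l) (w := fun y => Real.exp (|x| * max 1 l) * w y)
    (DifferentiableOn.mul (by fun_prop) (hF.differentiableOn.mono fun z => re_pos))
    (fun z hz => ?_) (hF.integrable.const_mul _) (by simpa using hF.tendsto_zero.const_mul _)
  · simp only [Complex.ofReal_one] at shift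
    rw [inverseLaplace, shift]
  · rw [norm_mul, Complex.norm_exp, Complex.re_ofReal_mul]
    gcongr
    · exact (re_pos hz).le
    · exact le_abs_self x
    · exact hz.2
    · exact hF.norm_le z (re_pos hz)

theorem norm_inverseLaplace_le (hl : 0 < l) (x : ℝ) :
    ‖inverseLaplace F x‖ ≤ Real.exp (x * l) * ((2 * Real.pi)⁻¹ * ∫ y, w y) := by
  have norm_eq : ‖(2 * Real.pi : ℂ)⁻¹‖ = (2 * Real.pi)⁻¹ := by
    rw [norm_inv, norm_mul, Complex.norm_ofNat, Complex.norm_real,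
      Real.norm_of_nonneg Real.pi_pos.le]
  rw [hF.inverseLaplace_eq hl, norm_mul, norm_eq, mul_left_comm, ← integral_const_mul]
  gcongr
  refine norm_integral_le_of_norm_le (hF.integrable.const_mul _) (.of_forall fun y => ?_)
  rw [norm_mul, Complex.norm_exp]
  gcongr
  · simp
  · exact hF.norm_vertical_line_le hl y

theorem inverseLaplace_of_neg {x : ℝ} (hx : x < 0) : inverseLaplace F x = 0 := by
  have bound_tendsto : Tendsto (fun l => Real.exp (x * l) * ((2 * Real.pi)⁻¹ * ∫ y, w y)) atTop
      (𝓝 0) := by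
    simpa using (Real.tendsto_exp_atBot.comp (tendsto_id.const_mul_atTop_of_neg hx)).mul_const
      ((2 * Real.pi)⁻¹ * ∫ y, w y)
  refine norm_le_zero_iff.1 (ge_of_tendsto bound_tendsto ?_)
  filter_upwards [eventually_gt_atTop 0] with l hl using hF.norm_inverseLaplace_le hl x

theorem fourierInv_vertical_line (hl : 0 < l) (x : ℝ) :
    𝓕⁻ (fun ξ : ℝ => F (l + (2 * Real.pi * ξ : ℝ) * Complex.I)) x =
      Real.exp (-(l * x)) * inverseLaplace F x := by
  have rescale := Measure.integral_comp_mul_left (fun y : ℝ =>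
    Complex.exp (x * (l + y * Complex.I)) * F (l + y * Complex.I)) (2 * Real.pi)
  rw [abs_of_pos (by positivity), Complex.real_smul] at rescale
  push_cast at rescale
  rw [hF.inverseLaplace_eq hl, ← rescale, ← integral_const_mul, Real.fourierInv_eq']
  refine integral_congr_ae (.of_forall fun ξ => ?_)
  simp only [smul_eq_mul, ← mul_assoc, Complex.ofReal_exp, ← Complex.exp_add]
  congr 2
  · simp only [RCLike.inner_apply, conj_trivial]
    push_cast
    ring
  · push_cast
    ring_nf

theorem integrable_rescaled_vertical_line (hl : 0 < l) :
    Integrable fun ξ : ℝ => F (l + (2 * Real.pi * ξ : ℝ) * Complex.I) :=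
  (hF.integrable_vertical_line hl).comp_mul_left' (by positivity)

theorem continuous_inverseLaplace : Continuous (inverseLaplace F) := by
  have fourier_continuous := VectorFourier.fourierIntegral_continuous Real.continuous_fourierChar
    (innerSL ℝ).continuous₂ (hF.integrable_rescaled_vertical_line one_pos)
  have eq_fourier : inverseLaplace F = fun x => (Real.exp x : ℂ) *
      𝓕 (fun ξ : ℝ => F ((1 : ℝ) + (2 * Real.pi * ξ : ℝ) * Complex.I)) (-x) := by
    funext x
    rw [← Real.fourierInv_eq_fourier_neg, hF.fourierInv_vertical_line one_pos, ← mul_assoc,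
      ← Complex.ofReal_mul, ← Real.exp_add, one_mul, add_neg_cancel, Real.exp_zero,
      Complex.ofReal_one, one_mul]
  rw [eq_fourier]
  exact (by fun_prop : Continuous fun x : ℝ => (Real.exp x : ℂ)).mul
    (fourier_continuous.comp continuous_neg)

theorem integrable_exp_mul_inverseLaplace (hl : 0 < l) :
    Integrable fun x : ℝ => (Real.exp (-(l * x)) : ℂ) * inverseLaplace F x := by
  set W := (2 * Real.pi)⁻¹ * ∫ y, w y
  have dominating : Integrable ((Ici (0 : ℝ)).indicator fun x => W * Real.exp (-(l / 2) * x)) := by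
    rw [integrable_indicator_iff measurableSet_Ici, integrableOn_Ici_iff_integrableOn_Ioi]
    exact (exp_neg_integrableOn_Ioi 0 (half_pos hl)).const_mul W
  have := hF.continuous_inverseLaplace
  refine dominating.mono' (Continuous.aestronglyMeasurable (by fun_prop)) (.of_forall fun x => ?_)
  rcases lt_or_ge x 0 with hx | hx
  · rw [hF.inverseLaplace_of_neg hx, mul_zero, norm_zero, indicator_of_notMem (notMem_Ici.2 hx)]
  · rw [indicator_of_mem (mem_Ici.2 hx), norm_mul, Complex.norm_real,
      Real.norm_of_nonneg (Real.exp_pos _).le]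
    calc Real.exp (-(l * x)) * ‖inverseLaplace F x‖
        ≤ Real.exp (-(l * x)) * (Real.exp (x * (l / 2)) * W) := by
          gcongr
          exact hF.norm_inverseLaplace_le (half_pos hl) x
      _ = W * Real.exp (-(l / 2) * x) := by
          rw [← mul_assoc, ← Real.exp_add, mul_comm]
          ring_nf

theorem integral_exp_mul_inverseLaplace (hl : 0 < l) :
    ∫ x : ℝ, (Real.exp (-(l * x)) : ℂ) * inverseLaplace F x = F l := by
  set G : ℝ → ℂ := fun ξ => F (l + (2 * Real.pi * ξ : ℝ) * Complex.I)
  have fourierInv_eq : 𝓕⁻ G = fun x : ℝ => (Real.exp (-(l * x)) : ℂ) * inverseLaplace F x :=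
    funext (hF.fourierInv_vertical_line hl)
  have continuous_G : Continuous G :=
    (hF.continuous_vertical_line hl).comp (continuous_const.mul continuous_id)
  have integrable_fourier : Integrable (𝓕 G) := by
    refine (fourierInv_eq ▸ hF.integrable_exp_mul_inverseLaplace hl).comp_neg.congr
      (.of_forall fun x => ?_)
    simp only [Real.fourierInv_eq_fourier_neg, neg_neg]
  have inversion := congrFun (continuous_G.fourier_fourierInv_eq
    (hF.integrable_rescaled_vertical_line hl) integrable_fourier) 0
  rw [Real.fourier_eq', fourierInv_eq] at inversion
  simpa [G] using inversion

theorem integrable_re_inverseLaplace_mul_exp (hl : 0 < l) :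
    Integrable fun x : ℝ => (inverseLaplace F x).re * Real.exp (-(l * x)) :=
  (hF.integrable_exp_mul_inverseLaplace hl).re.congr (.of_forall fun x => by
    simp only [RCLike.re_eq_complex_re, Complex.re_ofReal_mul, mul_comm (Real.exp _)])

theorem laplaceIntegrable_re_inverseLaplace :
    LaplaceIntegrable fun x => (inverseLaplace F x).re := fun _ hl =>
  (hF.integrable_re_inverseLaplace_mul_exp hl).integrableOn

theorem laplaceTransform_re_inverseLaplace (hl : 0 < l) :
    laplaceTransform (fun x => (inverseLaplace F x).re) l = (F l).re := by
  rw [laplaceTransform, ← integral_Ici_eq_integral_Ioi,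
    setIntegral_eq_integral_of_forall_compl_eq_zero fun x hx => by
      rw [hF.inverseLaplace_of_neg (notMem_Ici.1 hx), Complex.zero_re, zero_mul],
    ← hF.integral_exp_mul_inverseLaplace hl, ← RCLike.re_eq_complex_re,
    ← integral_re (hF.integrable_exp_mul_inverseLaplace hl)]
  simp only [RCLike.re_eq_complex_re, Complex.re_ofReal_mul, mul_comm (Real.exp _)]

end IsVerticallyDominated

/-! ### Existence -/

section Existence

variable {α : ℝ}

theorem integrable_exp_neg_mul_abs_rpow {κ : ℝ} (hα : 0 < α) (hκ : 0 < κ) :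
    Integrable fun y : ℝ => Real.exp (-(κ * |y| ^ α)) := by
  have integral_eq := (integral_comp_abs (f := fun y => Real.exp (-κ * y ^ α))).trans
    (congrArg (2 * ·) (integral_exp_neg_mul_rpow hα hκ))
  simp only [neg_mul] at integral_eq
  refine .of_integral_ne_zero (integral_eq.trans_ne (ne_of_gt ?_))
  have := Real.Gamma_pos_of_pos (by positivity : 0 < 1 / α + 1)
  positivity

theorem tendsto_exp_neg_mul_abs_rpow {κ : ℝ} (hα : 0 < α) (hκ : 0 < κ) :
    Tendsto (fun y : ℝ => Real.exp (-(κ * |y| ^ α))) (cocompact ℝ) (𝓝 0) :=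
  Real.tendsto_exp_neg_atTop_nhds_zero.comp <| Tendsto.const_mul_atTop hκ <|
    (tendsto_rpow_atTop hα).comp tendsto_norm_cocompact_atTop

theorem cos_mul_abs_im_rpow_le_re_cpow (hα0 : 0 ≤ α) (hα1 : α ≤ 1) {z : ℂ} (hz : 0 ≤ z.re) :
    Real.cos (Real.pi / 2 * α) * |z.im| ^ α ≤ (z ^ (α : ℂ)).re := by
  have hπ := Real.pi_pos
  have cos_nonneg : 0 ≤ Real.cos (Real.pi / 2 * α) :=
    Real.cos_nonneg_of_mem_Icc ⟨by nlinarith, by nlinarith⟩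
  have arg_le : |z.arg| ≤ Real.pi / 2 := Complex.abs_arg_le_pi_div_two_iff.2 hz
  have cos_le : Real.cos (Real.pi / 2 * α) ≤ Real.cos (z.arg * α) := by
    rw [← Real.cos_abs (z.arg * α), abs_mul, abs_of_nonneg hα0]
    exact Real.cos_le_cos_of_nonneg_of_le_pi (by positivity) (by nlinarith) (by gcongr)
  rw [Complex.cpow_ofReal_re, mul_comm]
  gcongr
  exact Complex.abs_im_le_norm z

theorem isVerticallyDominated_exp_neg_mul_cpow (hα0 : 0 < α) (hα1 : α < 1) {t : ℝ}
    (ht : 0 < t) :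
    IsVerticallyDominated (fun z => Complex.exp (-(t * z ^ (α : ℂ))))
      fun y => Real.exp (-(t * Real.cos (Real.pi / 2 * α) * |y| ^ α)) := by
  have hπ := Real.pi_pos
  have hκ : 0 < t * Real.cos (Real.pi / 2 * α) :=
    mul_pos ht (Real.cos_pos_of_mem_Ioo ⟨by nlinarith, by nlinarith⟩)
  refine ⟨fun z hz => ?_, fun z hz => ?_, integrable_exp_neg_mul_abs_rpow hα0 hκ,
    tendsto_exp_neg_mul_abs_rpow hα0 hκ⟩
  · have : DifferentiableAt ℂ (fun z : ℂ => z ^ (α : ℂ)) z :=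
      differentiableAt_id.cpow_const (.inl hz)
    exact DifferentiableAt.differentiableWithinAt (by fun_prop)
  · rw [Complex.norm_exp, Complex.neg_re, Complex.re_ofReal_mul, mul_assoc]
    gcongr
    exact cos_mul_abs_im_rpow_le_re_cpow hα0.le hα1.le (le_of_lt hz)

theorem exists_isPositiveStableKernel (hα0 : 0 < α) (hα1 : α < 1) :
    ∃ p : ℝ → ℝ → ℝ, IsPositiveStableKernel α p := by
  let F (t : ℝ) (z : ℂ) : ℂ := Complex.exp (-(t * z ^ (α : ℂ)))
  have hF {t : ℝ} (ht : 0 < t) := isVerticallyDominated_exp_neg_mul_cpow hα0 hα1 ht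
  have continuous_p {t : ℝ} (ht : 0 < t) : Continuous fun x => (inverseLaplace (F t) x).re :=
    Complex.continuous_re.comp (hF ht).continuous_inverseLaplace
  have laplace_p {t : ℝ} (ht : 0 < t) (l : ℝ) (hl : 0 < l) :
      laplaceTransform (fun x => (inverseLaplace (F t) x).re) l = Real.exp (-(t * l ^ α)) := by
    rw [(hF ht).laplaceTransform_re_inverseLaplace hl, ← Complex.ofReal_cpow hl.le,
      ← Complex.ofReal_mul, ← Complex.ofReal_neg, Complex.exp_ofReal_re]
  exact ⟨fun t x => (inverseLaplace (F t) x).re, {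
    continuousOn := fun t ht => (continuous_p ht).continuousOn
    nonneg := fun t ht x hx => (hF ht).laplaceIntegrable_re_inverseLaplace
      |>.nonneg_of_laplaceTransform_eq hα0.le hα1.le ht.le (laplace_p ht) hx
        (continuous_p ht).continuousAt
    integrableOn := fun t ht => (hF ht).laplaceIntegrable_re_inverseLaplace
    laplace := fun t ht => laplace_p ht }⟩

end Existence

/-! ### Necessity -/

theorem of_sum_mul_pow_eq_vandermonde_mul {R : Type*} [CommRing R] {n : ℕ} (c u v : Fin n → R) :
    (Matrix.of fun i j => ∑ l : Fin n, c l * (u i * v j) ^ (l : ℕ)) =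
      Matrix.vandermonde u * Matrix.diagonal c * (Matrix.vandermonde v).transpose := by
  ext i j
  rw [Matrix.of_apply, Matrix.mul_apply]
  refine Finset.sum_congr rfl fun l _ => ?_
  rw [Matrix.mul_diagonal, Matrix.transpose_apply, Matrix.vandermonde_apply,
    Matrix.vandermonde_apply, mul_pow]
  ring

theorem mul_mul_add_smul_eq {R ι : Type*} [CommRing R] [Fintype ι] [DecidableEq ι]
    {V W E E' : Matrix ι ι R} {c : R} (hV : IsUnit V.det) (hW : IsUnit W.det)
    (hE : E * E' = c • 1) (D S : Matrix ι ι R) :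
    V * (E * D) * W + c • S = V * (E * (D + E' * (V⁻¹ * S * W⁻¹))) * W := by
  have cancel : V * (c • (V⁻¹ * S * W⁻¹)) * W = c • S := by
    rw [mul_smul_comm, smul_mul_assoc, mul_assoc V⁻¹,
      Matrix.mul_nonsing_inv_cancel_left _ _ hV, Matrix.nonsing_inv_mul_cancel_right _ _ hW]
  rw [mul_add, ← mul_assoc E E', hE, smul_one_mul, mul_add, add_mul, cancel]

theorem det_vandermonde_pos {n : ℕ} {v : Fin n → ℝ} (hv : StrictMono v) :
    0 < (Matrix.vandermonde v).det := by
  rw [Matrix.det_vandermonde]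
  exact Finset.prod_pos fun i _ => Finset.prod_pos fun j hj =>
    sub_pos.2 (hv (Finset.mem_Ioi.1 hj))

section SmallMinors

variable {k : ℕ} {ψ : ℝ → ℝ}

theorem isLittleO_sub_sum_iteratedDeriv (hψ : ContDiff ℝ k ψ) :
    (fun w => ψ w - ∑ l : Fin (k + 1), (l ! : ℝ)⁻¹ * iteratedDeriv l ψ 0 * w ^ (l : ℕ))
      =o[𝓝 0] fun w => w ^ k := by
  have taylor := taylor_isLittleO_univ (x₀ := 0) hψ
  simp only [taylor_within_apply, iteratedDerivWithin_univ, sub_zero, smul_eq_mul] at taylor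
  refine taylor.congr_left fun w => ?_
  rw [Fin.sum_univ_eq_sum_range fun l => (l ! : ℝ)⁻¹ * iteratedDeriv l ψ 0 * w ^ l]
  simp only [mul_right_comm]

/-- The matrix of Taylor remainders of order `k` at `0` of `ψ (ε * (u i * v j))`, divided by
`ε ^ k`; the part of the matrix `ψ (ε * (u i * v j))` that is negligible as `ε → 0`. -/
noncomputable def scaledRemainder (ψ : ℝ → ℝ) (u v : Fin (k + 1) → ℝ) (ε : ℝ) :
    Matrix (Fin (k + 1)) (Fin (k + 1)) ℝ :=
  Matrix.of fun i j => (ψ (ε * (u i * v j)) - ∑ l : Fin (k + 1),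
    (l ! : ℝ)⁻¹ * iteratedDeriv l ψ 0 * (ε * (u i * v j)) ^ (l : ℕ)) / ε ^ k

theorem tendsto_scaledRemainder (hψ : ContDiff ℝ k ψ) (u v : Fin (k + 1) → ℝ) :
    Tendsto (scaledRemainder ψ u v) (𝓝[≠] 0) (𝓝 0) := by
  refine tendsto_pi_nhds.2 fun i => tendsto_pi_nhds.2 fun j => ?_
  have arg_tendsto : Tendsto (fun ε : ℝ => ε * (u i * v j)) (𝓝[≠] 0) (𝓝 0) :=
    ((continuous_mul_const _).tendsto' 0 0 (zero_mul _)).mono_left nhdsWithin_le_nhds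
  refine ((isLittleO_sub_sum_iteratedDeriv hψ).comp_tendsto arg_tendsto).trans_isBigO ?_
    |>.tendsto_div_nhds_zero
  refine ((Asymptotics.isBigO_refl (fun ε : ℝ => ε ^ k) _).const_mul_left
    ((u i * v j) ^ k)).congr_left fun ε => ?_
  rw [← mul_pow, mul_comm, Function.comp_apply]

/-- Row `l` of the Taylor part between the Vandermonde matrices has order `ε ^ l` with `l ≤ k`, so
that the remainder `o(ε ^ k)` is negligible in every row. -/
theorem of_comp_mul_eq_vandermonde_mul {u v : Fin (k + 1) → ℝ} (hu : Function.Injective u)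
    (hv : Function.Injective v) {ε : ℝ} (hε : ε ≠ 0) :
    (Matrix.of fun i j => ψ (ε * (u i * v j))) =
      Matrix.vandermonde u * (Matrix.diagonal (fun l : Fin (k + 1) => ε ^ (l : ℕ)) *
        (Matrix.diagonal (fun l : Fin (k + 1) => (l ! : ℝ)⁻¹ * iteratedDeriv l ψ 0) +
          Matrix.diagonal (fun l : Fin (k + 1) => ε ^ (k - l : ℕ)) * ((Matrix.vandermonde u)⁻¹ *
            scaledRemainder ψ u v ε * ((Matrix.vandermonde v).transpose)⁻¹))) *
        (Matrix.vandermonde v).transpose := by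
  have hV : IsUnit (Matrix.vandermonde u).det := (Matrix.det_vandermonde_ne_zero_iff.2 hu).isUnit
  have hW : IsUnit (Matrix.vandermonde v).transpose.det := by
    rw [Matrix.det_transpose]
    exact (Matrix.det_vandermonde_ne_zero_iff.2 hv).isUnit
  have scaling : Matrix.diagonal (fun l : Fin (k + 1) => ε ^ (l : ℕ)) *
      Matrix.diagonal (fun l : Fin (k + 1) => ε ^ (k - l : ℕ)) = ε ^ k • 1 := by
    simp only [Matrix.diagonal_mul_diagonal, ← pow_add,
      Nat.add_sub_cancel' (Nat.lt_succ_iff.1 (Fin.is_lt _)), Matrix.smul_one_eq_diagonal]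
  rw [← mul_mul_add_smul_eq hV hW scaling, Matrix.diagonal_mul_diagonal,
    ← of_sum_mul_pow_eq_vandermonde_mul]
  ext i j
  simp only [scaledRemainder, Matrix.add_apply, Matrix.smul_apply, Matrix.of_apply, smul_eq_mul,
    mul_div_cancel₀ _ (pow_ne_zero k hε), mul_pow ε, mul_left_comm, mul_assoc]
  ring

theorem tendsto_det_comp_mul_div_pow (hψ : ContDiff ℝ k ψ) {u v : Fin (k + 1) → ℝ}
    (hu : Function.Injective u) (hv : Function.Injective v) :
    Tendsto (fun ε => (∏ l : Fin (k + 1), (ε ^ (l : ℕ))⁻¹) *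
        (Matrix.of fun i j => ψ (ε * (u i * v j))).det) (𝓝[≠] 0)
      (𝓝 ((∏ l : Fin (k + 1), (l ! : ℝ)⁻¹ * iteratedDeriv l ψ 0) *
        ((Matrix.vandermonde u).det * (Matrix.vandermonde v).det))) := by
  have tendsto_diagonal : Tendsto (fun ε : ℝ => Matrix.diagonal
      fun l : Fin (k + 1) => ε ^ (k - l : ℕ)) (𝓝[≠] 0)
      (𝓝 (Matrix.diagonal fun l : Fin (k + 1) => (0 : ℝ) ^ (k - l : ℕ))) :=
    ((Continuous.matrix_diagonal (by fun_prop)).tendsto 0).mono_left nhdsWithin_le_nhds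
  have tendsto_middle := (tendsto_diagonal.mul (((tendsto_scaledRemainder hψ u v).const_mul
    (Matrix.vandermonde u)⁻¹).mul_const ((Matrix.vandermonde v).transpose)⁻¹)).const_add
      (Matrix.diagonal fun l : Fin (k + 1) => (l ! : ℝ)⁻¹ * iteratedDeriv l ψ 0)
  rw [mul_zero, zero_mul, mul_zero, add_zero] at tendsto_middle
  have limit := ((continuous_id.matrix_det.tendsto _).comp tendsto_middle).mul_const
    ((Matrix.vandermonde u).det * (Matrix.vandermonde v).det)
  rw [id, Matrix.det_diagonal] at limit
  refine limit.congr' ?_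
  filter_upwards [self_mem_nhdsWithin] with ε (hε : ε ≠ 0)
  have prod_ne_zero : ∏ l : Fin (k + 1), ε ^ (l : ℕ) ≠ 0 :=
    Finset.prod_ne_zero_iff.2 fun l _ => pow_ne_zero _ hε
  rw [of_comp_mul_eq_vandermonde_mul hu hv hε, Matrix.det_mul, Matrix.det_mul, Matrix.det_mul,
    Matrix.det_diagonal, Finset.prod_inv_distrib, Matrix.det_transpose, Function.comp_apply, id]
  field_simp

theorem prod_iteratedDeriv_nonneg (hψ : ContDiff ℝ k ψ) {u v : Fin (k + 1) → ℝ}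
    (hu : StrictMono u) (hv : StrictMono v)
    (hdet : ∀ ε, 0 < ε → 0 ≤ (Matrix.of fun i j => ψ (ε * (u i * v j))).det) :
    0 ≤ ∏ l ∈ Finset.range (k + 1), iteratedDeriv l ψ 0 := by
  have limit := (tendsto_det_comp_mul_div_pow hψ hu.injective hv.injective).mono_left
    (nhdsWithin_mono (s := Ioi 0) 0 fun ε (hε : 0 < ε) => hε.ne')
  have limit_nonneg := ge_of_tendsto limit <| by
    filter_upwards [self_mem_nhdsWithin] with ε (hε : 0 < ε)
    exact mul_nonneg (Finset.prod_nonneg fun l _ => by positivity) (hdet ε hε)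
  have prod_nonneg := nonneg_of_mul_nonneg_left limit_nonneg
    (mul_pos (det_vandermonde_pos hu) (det_vandermonde_pos hv))
  rw [Finset.prod_mul_distrib] at prod_nonneg
  rw [← Fin.prod_univ_eq_prod_range fun l => iteratedDeriv l ψ 0]
  exact nonneg_of_mul_nonneg_right prod_nonneg (Finset.prod_pos fun l _ => by positivity)

end SmallMinors

theorem iteratedDeriv_exp_mul_sub (a b : ℝ) (k : ℕ) :
    iteratedDeriv k (fun w => Real.exp w * (b - a * w)) =
      fun w => Real.exp w * (b - a * k - a * w) := by
  induction k with
  | zero => simp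
  | succ k ih =>
    rw [iteratedDeriv_succ, ih]
    funext w
    refine ((Real.hasDerivAt_exp w).mul
      (((hasDerivAt_id w).const_mul a).const_sub (b - a * k))).deriv.trans ?_
    simp only [id]
    push_cast
    ring

section Necessity

variable {α : ℝ} {p : ℝ → ℝ → ℝ} {n : ℕ}

theorem IsPositiveStableKernel.det_stableMoment_nonneg (hp : IsPositiveStableKernel α p)
    (hTP : IsTotallyPositive n (Ioi 0) p) {m : ℕ} (hm : 1 ≤ m) (hmn : m ≤ n) (k : ℕ)
    {t l : Fin m → ℝ} (ht : StrictMono t) (hl : StrictAnti l) (ht0 : ∀ i, 0 < t i)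
    (hl0 : ∀ j, 0 < l j) : 0 ≤ (Matrix.of fun i j => stableMoment α k (t i) (l j)).det := by
  have hf (i) : LaplaceIntegrable (p (t i)) := hp.integrableOn _ (ht0 i)
  have moment (i j) : stableMoment α k (t i) (l j) =
      ∫ x in Ioi (0 : ℝ), p (t i) x * (x ^ k * Real.exp (-(l j * x))) := by
    rw [← (hf i).laplaceTransform_pow_mul_eq_stableMoment (hp.laplace _ (ht0 i)) k (hl0 j),
      laplaceTransform]
    simp only [mul_assoc, mul_left_comm]
  simp only [moment]
  refine det_integral_mul_nonneg (L := fun j x => x ^ k * Real.exp (-(l j * x)))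
    (ae_restrict_mem measurableSet_Ioi) (fun i j => ?_)
    (fun s hs hs0 => hTP m hm hmn t s ht hs ht0 hs0) fun s hs hs0 => ?_
  · refine ((hf i).pow_mul k (hl0 j)).congr (.of_forall fun x => ?_)
    simp only [mul_assoc, mul_left_comm]
  · have scale := Matrix.det_mul_column (fun i => s i ^ k)
      (Matrix.of fun i j => Real.exp (s i * -l j))
    have exp_nonneg := det_exp_mul_nonneg hs (y := fun j => -l j) hl.neg
    simp only [Matrix.of_apply, mul_neg, mul_comm (s _) (l _)] at scale exp_nonneg
    exact (mul_nonneg (Finset.prod_nonneg fun i _ => pow_nonneg (le_of_lt (hs0 i)) k)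
      exp_nonneg).trans_eq scale.symm

theorem IsPositiveStableKernel.det_exp_mul_sub_nonneg (hα0 : 0 < α)
    (hp : IsPositiveStableKernel α p) (hTP : IsTotallyPositive n (Ioi 0) p) {m : ℕ}
    (hm : 1 ≤ m) (hmn : m ≤ n) {t y : Fin m → ℝ} (ht : StrictMono t) (hy : StrictMono y)
    (ht0 : ∀ i, 0 < t i) (hy0 : ∀ j, y j < 0) :
    0 ≤ (Matrix.of fun i j => Real.exp (t i * y j) * (1 - α - α * (t i * y j))).det := by
  set l : Fin m → ℝ := fun j => (-y j) ^ α⁻¹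
  have neg_y_pos (j) : 0 < -y j := neg_pos.2 (hy0 j)
  have hl0 (j) : 0 < l j := Real.rpow_pos_of_pos (neg_y_pos j) _
  have rpow_l (j) : l j ^ α = -y j := Real.rpow_inv_rpow (neg_y_pos j).le hα0.ne'
  have moment (i j) : stableMoment α 2 (t i) (l j) =
      α * t i * ((l j ^ 2)⁻¹ * -y j *
        (Real.exp (t i * y j) * (1 - α - α * (t i * y j)))) := by
    rw [stableMoment_two, rpow_l, mul_neg, neg_neg]
    ring
  have det_nonneg : 0 ≤ (Matrix.of fun i j => stableMoment α 2 (t i) (l j)).det :=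
    hp.det_stableMoment_nonneg hTP hm hmn 2 ht (fun i j hij => Real.rpow_lt_rpow
      (neg_y_pos j).le (neg_lt_neg (hy hij)) (inv_pos.2 hα0)) ht0 hl0
  have scaling : (Matrix.of fun i j => stableMoment α 2 (t i) (l j)).det =
      (∏ i, α * t i) * ((∏ j, (l j ^ 2)⁻¹ * -y j) * (Matrix.of fun i j =>
        Real.exp (t i * y j) * (1 - α - α * (t i * y j))).det) := by
    rw [← Matrix.det_mul_row, ← Matrix.det_mul_column]
    simp only [moment, Matrix.of_apply]
  rw [scaling] at det_nonneg
  refine nonneg_of_mul_nonneg_right (nonneg_of_mul_nonneg_right det_nonneg ?_) ?_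
  · exact Finset.prod_pos fun i _ => mul_pos hα0 (ht0 i)
  · exact Finset.prod_pos fun j _ => mul_pos (inv_pos.2 (pow_pos (hl0 j) 2)) (neg_y_pos j)

theorem IsPositiveStableKernel.prod_one_sub_mul_nonneg (hα0 : 0 < α)
    (hp : IsPositiveStableKernel α p) (hTP : IsTotallyPositive n (Ioi 0) p) {k : ℕ}
    (hk : k + 1 ≤ n) : 0 ≤ ∏ l ∈ Finset.range (k + 1), (1 - (l + 1) * α) := by
  let u (i : Fin (k + 1)) : ℝ := i + 1
  let v (j : Fin (k + 1)) : ℝ := j - (k + 1)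
  have cast_strictMono : StrictMono fun i : Fin (k + 1) => (i : ℝ) := fun i j hij =>
    Nat.cast_lt.2 hij
  have hu : StrictMono u := cast_strictMono.add_const 1
  have hv : StrictMono v := fun i j hij => sub_lt_sub_right (cast_strictMono hij) _
  have hv0 (j) : v j < 0 := sub_neg.2 (by exact_mod_cast j.isLt)
  have nonneg := prod_iteratedDeriv_nonneg (k := k)
    (ψ := fun w => Real.exp w * (1 - α - α * w)) (by fun_prop) hu hv fun ε hε => by
      have det_nonneg := hp.det_exp_mul_sub_nonneg hα0 hTP k.succ_pos hk
        (t := fun i => ε * u i) (fun i j hij => mul_lt_mul_of_pos_left (hu hij) hε) hv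
        (fun i => mul_pos hε (by positivity)) hv0
      simpa only [mul_assoc] using det_nonneg
  refine nonneg.trans_eq (Finset.prod_congr rfl fun l _ => ?_)
  simp only [iteratedDeriv_exp_mul_sub, Real.exp_zero]
  ring

theorem IsPositiveStableKernel.not_isTotallyPositive (hα0 : 0 < α)
    (hp : IsPositiveStableKernel α p) {k : ℕ} (hkn : k + 1 ≤ n) (hk : k * α < 1)
    (hk1 : 1 < (k + 1) * α) : ¬ IsTotallyPositive n (Ioi 0) p := by
  intro hTP
  have nonneg := hp.prod_one_sub_mul_nonneg hα0 hTP hkn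
  rw [Finset.prod_range_succ] at nonneg
  refine (sub_neg.2 hk1).not_ge (nonneg_of_mul_nonneg_right nonneg
    (Finset.prod_pos fun l hl => sub_pos.2 (lt_of_le_of_lt ?_ hk)))
  have : (l : ℝ) + 1 ≤ k := by exact_mod_cast Finset.mem_range.1 hl
  gcongr

end Necessity

theorem exists_mul_lt_one_lt_succ_mul {α : ℝ} (hα0 : 0 < α) (hα1 : α < 1) {n : ℕ} (hn : 2 ≤ n)
    (hge : 1 / (n : ℝ) ≤ α) (hne : ∀ k : ℕ, 2 ≤ k → k ≤ n → α ≠ 1 / (k : ℝ)) :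
    ∃ k : ℕ, k + 1 ≤ n ∧ k * α < 1 ∧ 1 < (k + 1) * α := by
  have hn0 : (0 : ℝ) < n := by positivity
  have one_lt_inv : 1 < α⁻¹ := (one_lt_inv₀ hα0).2 hα1
  have inv_lt : α⁻¹ < n := by
    rw [inv_lt_comm₀ hα0 hn0, ← one_div]
    exact hge.lt_of_ne' (hne n hn le_rfl)
  have floor_le : (⌊α⁻¹⌋₊ : ℝ) ≤ α⁻¹ := Nat.floor_le (by positivity)
  have floor_lt : ⌊α⁻¹⌋₊ < n := by exact_mod_cast floor_le.trans_lt inv_lt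
  have floor_ne : (⌊α⁻¹⌋₊ : ℝ) ≠ α⁻¹ := fun h =>
    hne ⌊α⁻¹⌋₊ (by exact_mod_cast one_lt_inv.trans_eq h.symm) floor_lt.le
      (by rw [h, one_div, inv_inv])
  refine ⟨⌊α⁻¹⌋₊, floor_lt, ?_, ?_⟩
  · exact (lt_inv_mul_iff₀' hα0).1 (by simpa using floor_le.lt_of_ne floor_ne)
  · exact (inv_lt_iff_one_lt_mul₀ hα0).1 (Nat.lt_floor_add_one _)

theorem theorem1 (α : ℝ) (hα0 : 0 < α) (hα1 : α < 1) :
    (∃ p : ℝ → ℝ → ℝ, IsPositiveStableKernel α p) ∧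
    ∀ p : ℝ → ℝ → ℝ, IsPositiveStableKernel α p →
      ∀ n : ℕ, 2 ≤ n →
        (IsTotallyPositive n (Ioi 0) p ↔
          (∃ k : ℕ, 2 ≤ k ∧ k ≤ n ∧ α = 1 / (k : ℝ)) ∨ α < 1 / (n : ℝ)) := by
  refine ⟨exists_isPositiveStableKernel hα0 hα1, fun p hp n hn => ⟨fun hTP => ?_, ?_⟩⟩
  · by_contra! h
    obtain ⟨k, hkn, hk, hk1⟩ := exists_mul_lt_one_lt_succ_mul hα0 hα1 hn h.2 h.1
    exact hp.not_isTotallyPositive hα0 hkn hk hk1 hTP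
  · rintro (⟨k, hk2, -, rfl⟩ | h)
    · have hk : ((1 : ℝ) / k)⁻¹ = k := by rw [one_div, inv_inv]
      exact hp.isTotallyPositive (by rw [hk]; exact_mod_cast hk2) (.inl ⟨k, hk.symm⟩)
    · have hn2 : (2 : ℝ) ≤ n := Nat.ofNat_le_cast.2 hn
      have hle : (n : ℝ) ≤ α⁻¹ := (le_inv_comm₀ (by linarith) hα0).2 (one_div (n : ℝ) ▸ h.le)
      exact hp.isTotallyPositive (hn2.trans hle) (.inr hle)
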